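/- **Theorem 2 (Slow heating).** There is a universal numerical constant $C>0$ (independent of all parameters below, in particular of the dimension, the local dimension, the volume and the frequency) for which the following holds. *Setting.* Let $\Lambda\subset\mathbb Z^d$ be finite and $\mathcal H_\Lambda=(\mathbb C^q)^{\otimes\Lambda}$. Let $\mathcal P_c(\Lambda)$ be the set of nonempty subsets of $\Lambda$ that are connected by nearest-neighbour adjacency. Let $H(t)=\sum_{S\in\mathcal P_c(\Lambda)}H_S(t)$ be Hermitian for every $t$, where $H_S(t)$ acts within $S$ (it is an operator on the tensor factors in $S$, tensored with the identity) and $t\mapsto H_S(t)$ is measurable, bounded and $T$-periodic, $T>0$. Write $\langle f\rangle=\frac1T\int_0^Tf(t)\,dt$, and put $D_S=\langle H_S\rangle$, $V_S(t)=H_S(t)-D_S$, $D=\sum_SD_S=\langle H\rangle$, $V(t)=H(t)-D$. For a family $Z=(Z_S(t))_S$ let $$\|Z\|_\kappa=\sup_{x\in\Lambda}\sum_{S\in\mathcal P_c(\Lambda):\,S\ni x}e^{\kappa|S|}\sup_t\|Z_S(t)\| .$$ Let $U(t)=1-i\int_0^tH(s)U(s)\,ds$. Let $\nu=2\pi/T$,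 let $\kappa_0>0$, and put $$\nu_0=\frac{54\pi}{\kappa_0^2}\big(\|D\|_{\kappa_0}+2\|V\|_{\kappa_0}\big),\qquad n_*=\Big\lfloor\frac{\nu/\nu_0}{(1+\ln(\nu/\nu_0))^3}\Big\rfloor-2 .$$ Assume $\nu_0>0$, $\nu\ge 9\pi\|V\|_{\kappa_0}/\kappa_0$, $\nu\ge\nu_0$ and $n_*\ge1$. *Effective Hamiltonian.* Let $H_0=H$ and, for $k\ge0$, let $D_k=\langle H_k\rangle$, $V_k=H_k-D_k$, $A_k(t)=-i\int_0^tV_k(s)\,ds$ and $$H_{k+1}=e^{-A_k}H_ke^{A_k}-i\,e^{-A_k}\partial_te^{A_k}=e^{-A_k}H_ke^{A_k}-\int_0^1e^{-sA_k}V_ke^{sA_k}\,ds ,$$ where the last expression is used as the definition for every $t$. Let $\widehat D$ be either of $D_{n_*}$, $D_{n_*+1}$. *Conclusion.* With $\widehat K_0=C\max\big(\|D\|_{\kappa_0},\tfrac{\nu_0}{\nu}\|V\|_{\kappa_0}\big)\|V\|_{\kappa_0}$ and $K_0=C\|D\|_{\kappa_0}\|V\|_{\kappa_0}$ (so that $\widehat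 K_0=K_0$ whenever $\|D\|_{\kappa_0}\ge\tfrac{\nu_0}{\nu}\|V\|_{\kappa_0}$), $$\frac1{|\Lambda|}\big\|U^*(t)\widehat D\,U(t)-\widehat D\big\|\le t\,\widehat K_0\,(2/3)^{n_*}\qquad\text{for all }t\in T\mathbb N,$$ $$\frac1{|\Lambda|}\big\|U^*(t)D\,U(t)-D\big\|\le t\,K_0\,(2/3)^{n_*}+C\,\frac{\nu_0}{\nu}\,\|V\|_{\kappa_0}\qquad\text{for all }t\ge0 .$$ -/

import Mathlib

open MeasureTheory

noncomputable section

namespace SlowHeating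

/-- The graph on the lattice `ℤ^d` joining points at `ℓ¹`-distance one. -/
def latticeGraph (d : ℕ) : SimpleGraph (Fin d → ℤ) where
  Adj x y := ∑ i, |x i - y i| = 1
  symm := ⟨fun x y h => by simpa only [abs_sub_comm] using h⟩
  loopless := ⟨fun x h => by simp at h⟩

open Classical in
/-- The nonempty subsets of `Λ` that are connected by adjacency in `ℤ^d`. -/
def connSets {d : ℕ} (Λ : Finset (Fin d → ℤ)) : Finset (Finset (Fin d → ℤ)) :=
  Λ.powerset.filter fun S => ((latticeGraph d).induce (S : Set (Fin d → ℤ))).Connected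

/-- The tensor product of copies of `ℂ^q` over the sites of `Λ`, realised as the Hilbert space
with orthonormal basis the configurations `Λ → {0, …, q-1}`. -/
abbrev Hilb {d : ℕ} (Λ : Finset (Fin d → ℤ)) (q : ℕ) : Type :=
  EuclideanSpace ℂ (Λ → Fin q)

/-- The bounded operators on `Hilb Λ q`, with the operator norm. -/
abbrev Obs {d : ℕ} (Λ : Finset (Fin d → ℤ)) (q : ℕ) : Type :=
  Hilb Λ q →L[ℂ] Hilb Λ q

open Classical in
/-- `Z` is of the form `1 ⊗ O`, with `O` an operator on the tensor factors in `S`: in the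
configuration basis, `⟨σ|Z|τ⟩` vanishes unless `σ = τ` off `S`, and otherwise it is
`⟨σ|_S| O |τ|_S⟩`. -/
def ActsWithin {d : ℕ} {Λ : Finset (Fin d → ℤ)} {q : ℕ} (S : Finset (Fin d → ℤ))
    (Z : Obs Λ q) : Prop :=
  ∃ O : Matrix ({x : Λ // x.1 ∈ S} → Fin q) ({x : Λ // x.1 ∈ S} → Fin q) ℂ,
    Z = Matrix.toEuclideanCLM (𝕜 := ℂ) (Matrix.of fun σ τ : Λ → Fin q =>
      if ∀ x : Λ, x.1 ∉ S → σ x = τ x then O (fun x => σ x.1) (fun x => τ x.1) else 0)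

/-- A time-dependent family of operators indexed by finite sets of sites; only the sets in
`connSets Λ` ever matter. -/
abbrev Potential {d : ℕ} (Λ : Finset (Fin d → ℤ)) (q : ℕ) : Type :=
  Finset (Fin d → ℤ) → ℝ → Obs Λ q

/-- The operator `Z(t) = ∑_S Z_S(t)`. -/
def total {d : ℕ} {Λ : Finset (Fin d → ℤ)} {q : ℕ} (Z : Potential Λ q) (t : ℝ) : Obs Λ q :=
  ∑ S ∈ connSets Λ, Z S t

open Classical in
/-- `‖Z‖_κ = sup_{x ∈ Λ} ∑_{S ∋ x} e^{κ|S|} sup_t ‖Z_S(t)‖`. -/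
def potNorm {d : ℕ} {Λ : Finset (Fin d → ℤ)} {q : ℕ} (κ : ℝ) (Z : Potential Λ q) : ℝ :=
  ⨆ x : Λ, ∑ S ∈ (connSets Λ).filter (fun S => x.1 ∈ S),
    Real.exp (κ * (S.card : ℝ)) * ⨆ t : ℝ, ‖Z S t‖

/-- The potential `(H_S(t))` of a driven Hamiltonian: local terms that are measurable, bounded and
`T`-periodic in time, with Hermitian sum `H(t)`. -/
structure IsDriven {d : ℕ} {Λ : Finset (Fin d → ℤ)} {q : ℕ} (T : ℝ) (H : Potential Λ q) :
    Prop where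
  actsWithin : ∀ S ∈ connSets Λ, ∀ t, ActsWithin S (H S t)
  measurable : ∀ S ∈ connSets Λ, AEStronglyMeasurable (H S) volume
  bounded : ∀ S ∈ connSets Λ, ∃ B : ℝ, ∀ t, ‖H S t‖ ≤ B
  periodic : ∀ S ∈ connSets Λ, ∀ t, H S (t + T) = H S t
  hermitian : ∀ t, star (total H t) = total H t

/-- The time average `⟨f⟩ = (1/T) ∫_0^T f`. -/
def avg {d : ℕ} {Λ : Finset (Fin d → ℤ)} {q : ℕ} (T : ℝ) (f : ℝ → Obs Λ q) : Obs Λ q :=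
  (1 / T : ℝ) • ∫ t in (0 : ℝ)..T, f t

/-- The oscillating part `f - ⟨f⟩`. -/
def osc {d : ℕ} {Λ : Finset (Fin d → ℤ)} {q : ℕ} (T : ℝ) (f : ℝ → Obs Λ q) (t : ℝ) : Obs Λ q :=
  f t - avg T f

/-- The potential `D_S = ⟨H_S⟩` of the averaged Hamiltonian. -/
def avgPot {d : ℕ} {Λ : Finset (Fin d → ℤ)} {q : ℕ} (T : ℝ) (H : Potential Λ q) : Potential Λ q :=
  fun S _ => avg T (H S)

/-- The potential `V_S = H_S - D_S` of the driving. -/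
def oscPot {d : ℕ} {Λ : Finset (Fin d → ℤ)} {q : ℕ} (T : ℝ) (H : Potential Λ q) : Potential Λ q :=
  fun S => osc T (H S)

/-- `U` is the unitary evolution generated by `t ↦ h t`:
`U(t) = 1 - i ∫_0^t h(s) U(s) ds`. -/
def IsPropagator {d : ℕ} {Λ : Finset (Fin d → ℤ)} {q : ℕ} (h : ℝ → Obs Λ q) (U : ℝ → Obs Λ q) :
    Prop :=
  Continuous U ∧ ∀ t : ℝ, U t = 1 - Complex.I • ∫ s in (0 : ℝ)..t, h s * U s

/-- The generator `A` of the transformation that removes the oscillating part of `h` to first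
order: `∂_t A = -i (h - ⟨h⟩)`, `A(0) = 0`. -/
def rotGen {d : ℕ} {Λ : Finset (Fin d → ℤ)} {q : ℕ} (T : ℝ) (h : ℝ → Obs Λ q) (t : ℝ) : Obs Λ q :=
  -(Complex.I • ∫ s in (0 : ℝ)..t, osc T h s)

/-- The Hamiltonian `e^{-A} h e^{A} - i e^{-A} ∂_t e^{A}` in the frame rotated by `e^{-A(t)}`,
where `A = rotGen T h`. The derivative is written out by
`e^{-A} ∂_t e^{A} = ∫_0^1 e^{-sA} (∂_t A) e^{sA} ds` and `∂_t A = -i (h - ⟨h⟩)`. -/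
def rotate {d : ℕ} {Λ : Finset (Fin d → ℤ)} {q : ℕ} (T : ℝ) (h : ℝ → Obs Λ q) (t : ℝ) : Obs Λ q :=
  NormedSpace.exp (-rotGen T h t) * h t * NormedSpace.exp (rotGen T h t) -
    ∫ s in (0 : ℝ)..1,
      NormedSpace.exp (-(s • rotGen T h t)) * osc T h t * NormedSpace.exp (s • rotGen T h t)

/-- The renormalised Hamiltonians `H_0 = h`, `H_{k+1} = rotate H_k`. -/
def renHam {d : ℕ} {Λ : Finset (Fin d → ℤ)} {q : ℕ} (T : ℝ) (h : ℝ → Obs Λ q) :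
    ℕ → ℝ → Obs Λ q
  | 0 => h
  | k + 1 => rotate T (renHam T h k)

/-- The effective Hamiltonian `D_k = ⟨H_k⟩` of order `k`. -/
def effHam {d : ℕ} {Λ : Finset (Fin d → ℤ)} {q : ℕ} (T : ℝ) (h : ℝ → Obs Λ q) (k : ℕ) : Obs Λ q :=
  avg T (renHam T h k)

/-- `ν₀ = (54π/κ₀²) (‖D‖_{κ₀} + 2 ‖V‖_{κ₀})`. -/
def nuZero {d : ℕ} {Λ : Finset (Fin d → ℤ)} {q : ℕ} (T κ₀ : ℝ) (H : Potential Λ q) : ℝ :=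
  54 * Real.pi / κ₀ ^ 2 * (potNorm κ₀ (avgPot T H) + 2 * potNorm κ₀ (oscPot T H))

/-- `n_* = ⌊r / (1 + ln r)³⌋ - 2` with `r = ν/ν₀`. -/
def nStar (r : ℝ) : ℤ :=
  ⌊r / (1 + Real.log r) ^ 3⌋ - 2

end SlowHeating

end

/-! Write H = D + V with D = ⟨H⟩. Passing to the frame e^{-A} with ∂_t A = -iV cancels V to first
order: what remains beside D consists of commutators of A with D and V, and A has size at most T
times that of V, being T-periodic with A(0) = 0. At high frequency each rotation therefore shrinks
the driving by a constant factor. The price is locality, measured by the exponential rate κ in the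
weighted norm. The first rotation spends half of the rate and gains a factor of order 1/r, r = ν/ν₀;
each later one spends κ/(2N) and gains 2/3. The condition 8N ≤ r makes N rotations affordable
(`IsRegular.renHam_mem_localBall`).

All frames coincide at multiples of T, so there U is also the evolution generated by H_k = D_k +
V_k. The derivative of U* D_k U is i U* [V_k, D_k] U, since D_k commutes with itself, and its norm
is at most 2|Λ| times the local sizes of V_k and D_k, because terms with disjoint supports commute
(`norm_commutator_le_of_mem_localBall`). Replacing D_k by D costs |Λ| times order ‖V‖/r, and a time
between two multiples of T costs at most one period of drift.

Locality is recorded by sets of operators, `localBall`: some decomposition with weighted norm at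
most M exists. These sets are convex and closed, so time averages, integrals and convergent series
stay inside them and no measurable choice of decompositions is needed. The basic estimate is
`commutator_mem_localBall`; iterated and summed against 1/n! it gives `exp_conj_sub_mem_localBall`,
which controls conjugation by e^A. As H is only measurable in time, differential equations hold
almost everywhere, for locally Lipschitz functions. -/

noncomputable section

namespace SlowHeating

/-! ### Operators acting within a set of sites -/

section Locality

variable {d : ℕ} {Λ : Finset (Fin d → ℤ)} {q : ℕ}

open Classical in
/-- The matrix, in the configuration basis, of `1 ⊗ O`. -/
def localMatrix (S : Finset (Fin d → ℤ))
    (O : Matrix ({x : Λ // x.1 ∈ S} → Fin q) ({x : Λ // x.1 ∈ S} → Fin q) ℂ) :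
    Matrix (Λ → Fin q) (Λ → Fin q) ℂ :=
  Matrix.of fun σ τ : Λ → Fin q =>
    if ∀ x : Λ, x.1 ∉ S → σ x = τ x then O (fun x => σ x.1) (fun x => τ x.1) else 0

theorem actsWithin_iff {S : Finset (Fin d → ℤ)} {Z : Obs Λ q} :
    ActsWithin S Z ↔ ∃ O, Z = Matrix.toEuclideanCLM (𝕜 := ℂ) (localMatrix S O) :=
  Iff.rfl

-- Splitting a configuration into its parts on S and off S turns 1 ⊗ O into a literal Kronecker
-- product, from which multiplicativity is inherited.
open Kronecker in
theorem localMatrix_eq_kronecker (S : Finset (Fin d → ℤ))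
    (O : Matrix ({x : Λ // x.1 ∈ S} → Fin q) ({x : Λ // x.1 ∈ S} → Fin q) ℂ) :
    localMatrix S O = (O ⊗ₖ (1 : Matrix ({x : Λ // ¬ x.1 ∈ S} → Fin q) _ ℂ)).submatrix
      (Equiv.piEquivPiSubtypeProd (fun x : Λ => x.1 ∈ S) fun _ => Fin q)
      (Equiv.piEquivPiSubtypeProd (fun x : Λ => x.1 ∈ S) fun _ => Fin q) := by
  ext σ τ
  simp [localMatrix, Matrix.one_apply, funext_iff, Equiv.piEquivPiSubtypeProd]

theorem localMatrix_mul (S : Finset (Fin d → ℤ))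
    (O P : Matrix ({x : Λ // x.1 ∈ S} → Fin q) ({x : Λ // x.1 ∈ S} → Fin q) ℂ) :
    localMatrix S O * localMatrix S P = localMatrix S (O * P) := by
  simp only [localMatrix_eq_kronecker, Matrix.submatrix_mul_equiv, ← Matrix.mul_kronecker_mul,
    one_mul]

theorem localMatrix_add (S : Finset (Fin d → ℤ))
    (O P : Matrix ({x : Λ // x.1 ∈ S} → Fin q) ({x : Λ // x.1 ∈ S} → Fin q) ℂ) :
    localMatrix S O + localMatrix S P = localMatrix S (O + P) := by
  ext σ τ
  simp only [localMatrix, Matrix.add_apply, Matrix.of_apply]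
  split_ifs <;> simp

theorem localMatrix_smul (S : Finset (Fin d → ℤ)) (c : ℂ)
    (O : Matrix ({x : Λ // x.1 ∈ S} → Fin q) ({x : Λ // x.1 ∈ S} → Fin q) ℂ) :
    c • localMatrix S O = localMatrix S (c • O) := by
  ext σ τ
  simp only [localMatrix, Matrix.smul_apply, Matrix.of_apply]
  split_ifs <;> simp

open Classical in
theorem ActsWithin.mono {S S' : Finset (Fin d → ℤ)} (h : S ⊆ S') {Z : Obs Λ q}
    (hZ : ActsWithin S Z) : ActsWithin S' Z := by
  obtain ⟨O, rfl⟩ := actsWithin_iff.1 hZ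
  refine actsWithin_iff.2 ⟨Matrix.of fun a b =>
    if ∀ x : {x : Λ // x.1 ∈ S'}, x.1.1 ∉ S → a x = b x then
      O (fun x => a ⟨x.1, h x.2⟩) (fun x => b ⟨x.1, h x.2⟩) else 0, ?_⟩
  congr 1
  ext σ τ
  simp only [localMatrix, Matrix.of_apply]
  by_cases h1 : ∀ x : Λ, x.1 ∉ S → σ x = τ x
  · rw [if_pos h1, if_pos fun x hx => h1 x fun hS => hx (h hS), if_pos fun (x : {x : Λ // x.1 ∈ S'}) hx => h1 x.1 hx]
  · rw [if_neg h1]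
    by_cases h2 : ∀ x : Λ, x.1 ∉ S' → σ x = τ x
    · rw [if_pos h2, if_neg]
      intro h3
      refine h1 fun x hx => ?_
      by_cases hx' : x.1 ∈ S'
      · exact h3 ⟨x, hx'⟩ hx
      · exact h2 x hx'
    · rw [if_neg h2]

/-- The operators acting within `S`, as a subspace. -/
def actingWithin (S : Finset (Fin d → ℤ)) : Submodule ℂ (Obs Λ q) where
  carrier := {Z | ActsWithin S Z}
  zero_mem' := actsWithin_iff.2 ⟨0, by
    rw [← zero_smul ℂ (0 : Matrix _ _ ℂ), ← localMatrix_smul, zero_smul, map_zero]⟩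
  add_mem' := by
    intro Z W hZ hW
    obtain ⟨O, rfl⟩ := actsWithin_iff.1 hZ
    obtain ⟨P, rfl⟩ := actsWithin_iff.1 hW
    exact actsWithin_iff.2 ⟨O + P, by rw [← localMatrix_add, map_add]⟩
  smul_mem' := by
    intro c Z hZ
    obtain ⟨O, rfl⟩ := actsWithin_iff.1 hZ
    exact actsWithin_iff.2 ⟨c • O, by rw [← localMatrix_smul, map_smul]⟩

theorem ActsWithin.mul {S : Finset (Fin d → ℤ)} {Z W : Obs Λ q}
    (hZ : ActsWithin S Z) (hW : ActsWithin S W) : ActsWithin S (Z * W) := by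
  obtain ⟨O, rfl⟩ := actsWithin_iff.1 hZ
  obtain ⟨P, rfl⟩ := actsWithin_iff.1 hW
  exact actsWithin_iff.2 ⟨O * P, by rw [← localMatrix_mul, map_mul]⟩

theorem ActsWithin.commutator {S S' : Finset (Fin d → ℤ)} {Z W : Obs Λ q}
    (hZ : ActsWithin S Z) (hW : ActsWithin S' W) : ActsWithin (S ∪ S') (Z * W - W * Z) := by
  have hZ' := hZ.mono (Finset.subset_union_left (s₂ := S'))
  have hW' := hW.mono (Finset.subset_union_right (s₁ := S))
  exact (actingWithin (S ∪ S')).sub_mem (hZ'.mul hW') (hW'.mul hZ')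

-- Only one intermediate configuration contributes to the matrix product: τ on S and σ off S. The
-- result is symmetric in the two factors, whence operators with disjoint supports commute.
open Classical in
theorem localMatrix_mul_apply_of_disjoint {S S' : Finset (Fin d → ℤ)} (h : Disjoint S S')
    (O : Matrix ({x : Λ // x.1 ∈ S} → Fin q) ({x : Λ // x.1 ∈ S} → Fin q) ℂ)
    (P : Matrix ({x : Λ // x.1 ∈ S'} → Fin q) ({x : Λ // x.1 ∈ S'} → Fin q) ℂ)
    (σ τ : Λ → Fin q) :
    (localMatrix S O * localMatrix S' P) σ τ =
      if ∀ x : Λ, x.1 ∉ S → x.1 ∉ S' → σ x = τ x then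
        O (fun x => σ x.1) (fun x => τ x.1) * P (fun x => σ x.1) (fun x => τ x.1) else 0 := by
  rw [Matrix.mul_apply, Finset.sum_eq_single fun x => if x.1 ∈ S then τ x else σ x]
  · have hS' : ∀ x : {x : Λ // x.1 ∈ S'}, x.1.1 ∉ S := fun x hx =>
      Finset.disjoint_left.1 h hx x.2
    have h1 : ∀ x : Λ, x.1 ∉ S → σ x = if x.1 ∈ S then τ x else σ x := fun x hx => by
      rw [if_neg hx]
    have h2 : (∀ x : Λ, x.1 ∉ S' → (if x.1 ∈ S then τ x else σ x) = τ x) ↔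
        ∀ x : Λ, x.1 ∉ S → x.1 ∉ S' → σ x = τ x := by
      refine forall_congr' fun x => ?_
      by_cases hx : x.1 ∈ S <;> simp [hx]
    simp only [localMatrix, Matrix.of_apply]
    rw [if_pos h1]
    simp only [h2]
    split_ifs with h3
    · congr 2
      · ext x
        simp [x.2]
      · ext x
        simp [hS' x]
    · simp
  · intro ρ _ hρ
    simp only [localMatrix, Matrix.of_apply]
    by_contra hne
    refine hρ (funext fun x => ?_)
    have h1 : ∀ x : Λ, x.1 ∉ S → σ x = ρ x := by
      by_contra hc
      exact hne (by rw [if_neg hc, zero_mul])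
    have h2 : ∀ x : Λ, x.1 ∉ S' → ρ x = τ x := by
      by_contra hc
      exact hne (by rw [if_neg hc, mul_zero])
    split_ifs with hx
    · exact h2 x (Finset.disjoint_left.1 h hx)
    · exact (h1 x hx).symm
  · simp

theorem ActsWithin.commute {S S' : Finset (Fin d → ℤ)} (h : Disjoint S S') {Z W : Obs Λ q}
    (hZ : ActsWithin S Z) (hW : ActsWithin S' W) : Z * W = W * Z := by
  obtain ⟨O, rfl⟩ := actsWithin_iff.1 hZ
  obtain ⟨P, rfl⟩ := actsWithin_iff.1 hW
  rw [← map_mul, ← map_mul]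
  congr 1
  ext σ τ
  rw [localMatrix_mul_apply_of_disjoint h, localMatrix_mul_apply_of_disjoint h.symm]
  have : (∀ x : Λ, x.1 ∉ S → x.1 ∉ S' → σ x = τ x) ↔
      ∀ x : Λ, x.1 ∉ S' → x.1 ∉ S → σ x = τ x := forall_congr' fun x => by tauto
  simp only [this, mul_comm]

theorem mem_connSets {S : Finset (Fin d → ℤ)} : S ∈ connSets Λ ↔
    S ⊆ Λ ∧ ((latticeGraph d).induce (S : Set (Fin d → ℤ))).Connected := by
  classical
  simp [connSets]

theorem nonempty_of_mem_connSets {S : Finset (Fin d → ℤ)} (h : S ∈ connSets Λ) : S.Nonempty := by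
  obtain ⟨x⟩ := (mem_connSets.1 h).2.nonempty
  exact ⟨x.1, x.2⟩

theorem union_mem_connSets {S S' : Finset (Fin d → ℤ)} (h : S ∈ connSets Λ)
    (h' : S' ∈ connSets Λ) (hd : ¬ Disjoint S S') : S ∪ S' ∈ connSets Λ := by
  rw [mem_connSets] at *
  refine ⟨Finset.union_subset h.1 h'.1, ?_⟩
  rw [Finset.coe_union]
  refine SimpleGraph.induce_union_connected h.2.preconnected h'.2.preconnected ?_
  obtain ⟨x, hx, hx'⟩ := Finset.not_disjoint_iff.1 hd
  exact ⟨x, hx, hx'⟩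

end Locality

/-! ### Weighted locality norms and commutators -/

section LocalBall

variable {d : ℕ} {Λ : Finset (Fin d → ℤ)} {q : ℕ}

open Classical in
/-- The operators `∑_S Z_S`, `Z_S` acting within `S`, with
`sup_x ∑_{S ∋ x} e^{κ|S|} ‖Z_S‖ ≤ M`. -/
def localBall (Λ : Finset (Fin d → ℤ)) (q : ℕ) (κ M : ℝ) : Set (Obs Λ q) :=
  {O | ∃ Z : Finset (Fin d → ℤ) → Obs Λ q, (∀ S ∈ connSets Λ, ActsWithin S (Z S)) ∧
    (∀ x ∈ Λ, ∑ S ∈ (connSets Λ).filter (fun S => x ∈ S),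
      Real.exp (κ * (S.card : ℝ)) * ‖Z S‖ ≤ M) ∧ O = ∑ S ∈ connSets Λ, Z S}

theorem localBall_mono {κ M M' : ℝ} (h : M ≤ M') : localBall Λ q κ M ⊆ localBall Λ q κ M' := by
  rintro O ⟨Z, h1, h2, h3⟩
  exact ⟨Z, h1, fun x hx => (h2 x hx).trans h, h3⟩

/-- Every connected set has at least one site, so lowering the rate gains at least one factor
e^{κ'-κ}. This factor later makes the smallness condition uniform in κ₀. -/
theorem localBall_subset_exp_mul {κ κ' M : ℝ} (h : κ' ≤ κ) :
    localBall Λ q κ M ⊆ localBall Λ q κ' (Real.exp (κ' - κ) * M) := by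
  rintro O ⟨Z, h1, h2, h3⟩
  refine ⟨Z, h1, fun x hx => ?_, h3⟩
  refine le_trans ?_ (mul_le_mul_of_nonneg_left (h2 x hx) (Real.exp_pos _).le)
  rw [Finset.mul_sum]
  refine Finset.sum_le_sum fun S hS => ?_
  rw [← mul_assoc, ← Real.exp_add]
  refine mul_le_mul_of_nonneg_right (Real.exp_le_exp.2 ?_) (norm_nonneg _)
  have : (1 : ℝ) ≤ S.card := by
    exact_mod_cast (nonempty_of_mem_connSets (Finset.mem_filter.1 hS).1).card_pos
  nlinarith

theorem localBall_anti {κ κ' M : ℝ} (h : κ' ≤ κ) :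
    localBall Λ q κ M ⊆ localBall Λ q κ' M := by
  rintro O ⟨Z, h1, h2, h3⟩
  refine ⟨Z, h1, fun x hx => le_trans (Finset.sum_le_sum fun S _ => ?_) (h2 x hx), h3⟩
  gcongr

theorem zero_mem_localBall {κ M : ℝ} (hM : 0 ≤ M) : (0 : Obs Λ q) ∈ localBall Λ q κ M :=
  ⟨fun _ => 0, fun S _ => (actingWithin S).zero_mem, fun x _ => by simpa using hM, by simp⟩

theorem add_mem_localBall {κ M M' : ℝ} {O P : Obs Λ q} (hO : O ∈ localBall Λ q κ M)
    (hP : P ∈ localBall Λ q κ M') : O + P ∈ localBall Λ q κ (M + M') := by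
  obtain ⟨Z, h1, h2, rfl⟩ := hO
  obtain ⟨W, h4, h5, rfl⟩ := hP
  refine ⟨fun S => Z S + W S, fun S hS => (actingWithin S).add_mem (h1 S hS) (h4 S hS),
    fun x hx => ?_, Finset.sum_add_distrib.symm⟩
  refine le_trans ?_ (add_le_add (h2 x hx) (h5 x hx))
  rw [← Finset.sum_add_distrib]
  refine Finset.sum_le_sum fun S _ => ?_
  rw [← mul_add]
  exact mul_le_mul_of_nonneg_left (norm_add_le _ _) (Real.exp_pos _).le

theorem smul_mem_localBall {κ M : ℝ} {O : Obs Λ q} (c : ℂ) (hO : O ∈ localBall Λ q κ M) :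
    c • O ∈ localBall Λ q κ (‖c‖ * M) := by
  obtain ⟨Z, h1, h2, rfl⟩ := hO
  refine ⟨fun S => c • Z S, fun S hS => (actingWithin S).smul_mem c (h1 S hS),
    fun x hx => ?_, Finset.smul_sum⟩
  refine le_trans (le_of_eq ?_) (mul_le_mul_of_nonneg_left (h2 x hx) (norm_nonneg c))
  rw [Finset.mul_sum]
  refine Finset.sum_congr rfl fun S _ => ?_
  rw [norm_smul]
  ring

theorem coe_smul_obs (c : ℝ) (O : Obs Λ q) : (c : ℂ) • O = c • O :=
  algebraMap_smul ℂ c O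

theorem real_smul_mem_localBall {κ M : ℝ} {O : Obs Λ q} (c : ℝ) (hO : O ∈ localBall Λ q κ M) :
    c • O ∈ localBall Λ q κ (|c| * M) := by
  have := smul_mem_localBall (c : ℂ) hO
  rwa [Complex.norm_real, Real.norm_eq_abs, coe_smul_obs] at this

theorem neg_mem_localBall {κ M : ℝ} {O : Obs Λ q} (hO : O ∈ localBall Λ q κ M) :
    -O ∈ localBall Λ q κ M := by
  have := smul_mem_localBall (-1 : ℂ) hO
  rwa [norm_neg, norm_one, one_mul, show (-1 : ℂ) • O = -O from neg_one_smul ℂ O] at this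

theorem sub_mem_localBall {κ M M' : ℝ} {O P : Obs Λ q} (hO : O ∈ localBall Λ q κ M)
    (hP : P ∈ localBall Λ q κ M') : O - P ∈ localBall Λ q κ (M + M') := by
  rw [sub_eq_add_neg]
  exact add_mem_localBall hO (neg_mem_localBall hP)

theorem convex_localBall (κ M : ℝ) : Convex ℝ (localBall Λ q κ M) := by
  intro O hO P hP a b ha hb hab
  have := add_mem_localBall (real_smul_mem_localBall a hO) (real_smul_mem_localBall b hP)
  rwa [abs_of_nonneg ha, abs_of_nonneg hb, ← add_mul, hab, one_mul] at this

/-- The ball is the image, under summation, of the set of admissible families. That set is compact: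
the space of families is finite-dimensional, and each term is bounded by M because its weight is at
least 1 and its support contains a site of Λ. -/
theorem isClosed_localBall {κ : ℝ} (hκ : 0 ≤ κ) (M : ℝ) : IsClosed (localBall Λ q κ M) := by
  classical
  let K : Set (connSets Λ → Obs Λ q) := {Z | (∀ S, ActsWithin S.1 (Z S)) ∧
    ∀ x ∈ Λ, ∑ S : connSets Λ, (if x ∈ S.1 then Real.exp (κ * (S.1.card : ℝ)) * ‖Z S‖ else 0) ≤ M}
  have hK : IsCompact K := by
    refine Metric.isCompact_of_isClosed_isBounded ?_ ?_
    · refine IsClosed.inter (s₁ := {Z : connSets Λ → Obs Λ q | ∀ S, ActsWithin S.1 (Z S)})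
        (s₂ := {Z : connSets Λ → Obs Λ q | ∀ x ∈ Λ,
        ∑ S : connSets Λ, (if x ∈ S.1 then Real.exp (κ * (S.1.card : ℝ)) * ‖Z S‖ else 0) ≤ M})
        ?_ ?_
      · simp only [Set.ofPred_forall]
        refine isClosed_iInter fun S => ?_
        have h := Submodule.closed_of_finiteDimensional (actingWithin S.1 : Submodule ℂ (Obs Λ q))
        exact h.preimage (f := fun Z : connSets Λ → Obs Λ q => Z S) (continuous_apply S)
      · simp only [Set.ofPred_forall]
        refine isClosed_iInter fun x => isClosed_iInter fun _ => ?_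
        refine isClosed_le (continuous_finsetSum _ fun S _ => ?_) continuous_const
        split_ifs <;> fun_prop
    · refine (Metric.isBounded_closedBall (x := 0) (r := max M 0)).subset fun Z hZ => ?_
      rw [mem_closedBall_zero_iff, pi_norm_le_iff_of_nonneg (le_max_right _ _)]
      intro S
      obtain ⟨x, hx⟩ := nonempty_of_mem_connSets S.2
      have h := hZ.2 x ((mem_connSets.1 S.2).1 hx)
      refine le_max_of_le_left (le_trans ?_ h)
      refine le_trans ?_ (Finset.single_le_sum (fun S _ => ?_) (Finset.mem_univ S))
      · rw [if_pos hx]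
        exact le_mul_of_one_le_left (norm_nonneg _) (Real.one_le_exp (by positivity))
      · split_ifs <;> positivity
  have : localBall Λ q κ M = (fun Z : connSets Λ → Obs Λ q => ∑ S, Z S) '' K := by
    ext O
    constructor
    · rintro ⟨Z, h1, h2, rfl⟩
      refine ⟨fun S => Z S.1, ⟨fun S => h1 S.1 S.2, fun x hx => ?_⟩, ?_⟩
      · refine le_trans (le_of_eq ?_) (h2 x hx)
        rw [Finset.sum_filter]
        exact Finset.sum_coe_sort (connSets Λ)
          fun S => if x ∈ S then Real.exp (κ * (S.card : ℝ)) * ‖Z S‖ else 0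
      · exact Finset.sum_coe_sort (connSets Λ) Z
    · rintro ⟨Z, ⟨h1, h2⟩, rfl⟩
      refine ⟨fun S => if h : S ∈ connSets Λ then Z ⟨S, h⟩ else 0, fun S hS => ?_,
        fun x hx => ?_, ?_⟩
      · simpa [hS] using h1 ⟨S, hS⟩
      · refine le_trans (le_of_eq ?_) (h2 x hx)
        rw [Finset.sum_filter, ← Finset.sum_coe_sort]
        refine Finset.sum_congr rfl fun S _ => ?_
        simp
      · rw [← Finset.sum_coe_sort]
        refine Finset.sum_congr rfl fun S _ => ?_
        simp
  rw [this]
  exact (hK.image (by fun_prop)).isClosed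

/-- A set meeting `S` contains a site of `S`, so a sum over the sets meeting `S` is
bounded by a sum over the sites of `S`. -/
theorem sum_not_disjoint_le [DecidableEq (Fin d → ℤ)] {b : Finset (Fin d → ℤ) → ℝ}
    (hb : ∀ S, 0 ≤ b S) {M : ℝ}
    (hM : ∀ x ∈ Λ, ∑ S ∈ (connSets Λ).filter (fun S => x ∈ S), b S ≤ M)
    {S : Finset (Fin d → ℤ)} (hS : S ⊆ Λ) :
    ∑ S' ∈ connSets Λ, (if Disjoint S S' then 0 else b S') ≤ S.card * M := by
  calc ∑ S' ∈ connSets Λ, (if Disjoint S S' then 0 else b S')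
      ≤ ∑ S' ∈ connSets Λ, ∑ x ∈ S, if x ∈ S' then b S' else 0 := by
        refine Finset.sum_le_sum fun S' _ => ?_
        have h0 : ∀ x ∈ S, 0 ≤ if x ∈ S' then b S' else 0 := fun x _ => by
          split_ifs <;> simp [hb]
        split_ifs with h
        · exact Finset.sum_nonneg h0
        · obtain ⟨x, hx, hx'⟩ := Finset.not_disjoint_iff.1 h
          refine le_trans ?_ (Finset.single_le_sum h0 hx)
          rw [if_pos hx']
    _ = ∑ x ∈ S, ∑ S' ∈ (connSets Λ).filter (fun S' => x ∈ S'), b S' := by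
        rw [Finset.sum_comm]
        simp only [Finset.sum_filter]
    _ ≤ ∑ x ∈ S, M := Finset.sum_le_sum fun x hx => hM x (hS hx)
    _ = S.card * M := by simp

/-- Double counting of pairs (site, set containing it); this is where the volume factor |Λ| arises.
-/
theorem sum_card_mul_le {b : Finset (Fin d → ℤ) → ℝ} {M : ℝ} [DecidableEq (Fin d → ℤ)]
    (hM : ∀ x ∈ Λ, ∑ S ∈ (connSets Λ).filter (fun S => x ∈ S), b S ≤ M) :
    ∑ S ∈ connSets Λ, S.card * b S ≤ Λ.card * M := by
  calc ∑ S ∈ connSets Λ, S.card * b S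
      = ∑ S ∈ connSets Λ, ∑ x ∈ Λ, if x ∈ S then b S else 0 := by
        refine Finset.sum_congr rfl fun S hS => ?_
        rw [← Finset.sum_filter, Finset.filter_mem_eq_inter,
          Finset.inter_eq_right.2 (mem_connSets.1 hS).1]
        simp
    _ = ∑ x ∈ Λ, ∑ S ∈ (connSets Λ).filter (fun S => x ∈ S), b S := by
        rw [Finset.sum_comm]
        simp only [Finset.sum_filter]
    _ ≤ ∑ x ∈ Λ, M := Finset.sum_le_sum hM
    _ = Λ.card * M := by simp

theorem norm_commutator_le_two (O P : Obs Λ q) : ‖O * P - P * O‖ ≤ 2 * ‖O‖ * ‖P‖ := by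
  calc ‖O * P - P * O‖ ≤ ‖O * P‖ + ‖P * O‖ := norm_sub_le _ _
    _ ≤ ‖O‖ * ‖P‖ + ‖P‖ * ‖O‖ := add_le_add (norm_mul_le _ _) (norm_mul_le _ _)
    _ = _ := by ring

theorem norm_le_of_mem_localBall {κ M : ℝ} (hκ : 0 ≤ κ) {O : Obs Λ q}
    (hO : O ∈ localBall Λ q κ M) : ‖O‖ ≤ Λ.card * M := by
  classical
  obtain ⟨Z, h1, h2, rfl⟩ := hO
  refine (norm_sum_le _ _).trans (le_trans (Finset.sum_le_sum fun S hS => ?_)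
    (sum_card_mul_le h2))
  have h3 : (1 : ℝ) ≤ S.card := by exact_mod_cast (nonempty_of_mem_connSets hS).card_pos
  have h4 : 1 ≤ Real.exp (κ * (S.card : ℝ)) := Real.one_le_exp (by positivity)
  calc ‖Z S‖ = 1 * (1 * ‖Z S‖) := by ring
    _ ≤ _ := by gcongr

theorem sum_norm_filter_le {κ M : ℝ} (hκ : 0 ≤ κ) [DecidableEq (Fin d → ℤ)]
    {Z : Finset (Fin d → ℤ) → Obs Λ q}
    (h : ∀ x ∈ Λ, ∑ S ∈ (connSets Λ).filter (fun S => x ∈ S),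
      Real.exp (κ * (S.card : ℝ)) * ‖Z S‖ ≤ M) (x : Fin d → ℤ) (hx : x ∈ Λ) :
    ∑ S ∈ (connSets Λ).filter (fun S => x ∈ S), ‖Z S‖ ≤ M := by
  refine le_trans (Finset.sum_le_sum fun S hS => ?_) (h x hx)
  exact le_mul_of_one_le_left (norm_nonneg _) (Real.one_le_exp (by positivity))

theorem commutator_sum_eq {Z W : Finset (Fin d → ℤ) → Obs Λ q}
    (hZ : ∀ S ∈ connSets Λ, ActsWithin S (Z S)) (hW : ∀ S ∈ connSets Λ, ActsWithin S (W S))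
    [DecidableEq (Fin d → ℤ)] :
    (∑ S ∈ connSets Λ, Z S) * (∑ S ∈ connSets Λ, W S) -
        (∑ S ∈ connSets Λ, W S) * (∑ S ∈ connSets Λ, Z S) =
      ∑ S ∈ connSets Λ, ∑ S' ∈ connSets Λ,
        if Disjoint S S' then 0 else Z S * W S' - W S' * Z S := by
  rw [Finset.sum_mul_sum, Finset.sum_mul_sum, Finset.sum_comm (s := connSets Λ) (t := connSets Λ)
    (f := fun i j => W i * Z j), ← Finset.sum_sub_distrib]
  refine Finset.sum_congr rfl fun S hS => ?_
  rw [← Finset.sum_sub_distrib]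
  refine Finset.sum_congr rfl fun S' hS' => ?_
  split_ifs with h
  · rw [(hZ S hS).commute h (hW S' hS'), sub_self]
  · rfl

/-- A term Z_S meets terms of P of total norm at most |S| M', and the sum of |S| ‖Z_S‖ is at most
|Λ| M by double counting. For the operator norm no decay rate has to be given up. -/
theorem norm_commutator_le_of_mem_localBall {κ M M' : ℝ} (hκ : 0 ≤ κ) {O P : Obs Λ q}
    (hO : O ∈ localBall Λ q κ M) (hP : P ∈ localBall Λ q κ M') (hM' : 0 ≤ M') :
    ‖O * P - P * O‖ ≤ 2 * Λ.card * M * M' := by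
  classical
  obtain ⟨Z, h1, h2, rfl⟩ := hO
  obtain ⟨W, h4, h5, rfl⟩ := hP
  rw [commutator_sum_eq h1 h4]
  calc ‖∑ S ∈ connSets Λ, ∑ S' ∈ connSets Λ,
        if Disjoint S S' then 0 else Z S * W S' - W S' * Z S‖
      ≤ ∑ S ∈ connSets Λ, 2 * ‖Z S‖ *
          ∑ S' ∈ connSets Λ, (if Disjoint S S' then 0 else ‖W S'‖) := by
        refine (norm_sum_le _ _).trans (Finset.sum_le_sum fun S hS => ?_)
        rw [Finset.mul_sum]
        refine (norm_sum_le _ _).trans (Finset.sum_le_sum fun S' hS' => ?_)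
        split_ifs
        · simp
        · exact norm_commutator_le_two _ _
    _ ≤ ∑ S ∈ connSets Λ, 2 * ‖Z S‖ * (S.card * M') := by
        refine Finset.sum_le_sum fun S hS => ?_
        exact mul_le_mul_of_nonneg_left (sum_not_disjoint_le (fun S => norm_nonneg (W S))
          (sum_norm_filter_le hκ h5) (mem_connSets.1 hS).1) (by positivity)
    _ = 2 * M' * ∑ S ∈ connSets Λ, S.card * ‖Z S‖ := by
        rw [Finset.mul_sum]
        refine Finset.sum_congr rfl fun S _ => ?_
        ring
    _ ≤ 2 * M' * (Λ.card * M) :=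
        mul_le_mul_of_nonneg_left (sum_card_mul_le (sum_norm_filter_le hκ h2)) (by positivity)
    _ = _ := by ring

/-- The maximum of n e^{-δn} is 1/(eδ): a lower rate absorbs a factor |S|. -/
theorem mul_exp_le {κ κ' : ℝ} (h : κ' < κ) (n : ℝ) :
    n * Real.exp (κ' * n) ≤ 1 / (Real.exp 1 * (κ - κ')) * Real.exp (κ * n) := by
  have h1 : (κ - κ') * n ≤ Real.exp ((κ - κ') * n - 1) := by
    have := Real.add_one_le_exp ((κ - κ') * n - 1)
    linarith
  have h2 : 0 < κ - κ' := sub_pos.2 h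
  have h3 : Real.exp (κ * n) =
      Real.exp 1 * (Real.exp ((κ - κ') * n - 1) * Real.exp (κ' * n)) := by
    rw [← Real.exp_add, ← Real.exp_add]
    ring_nf
  have h4 : 1 / (Real.exp 1 * (κ - κ')) * Real.exp (κ * n) =
      Real.exp ((κ - κ') * n - 1) / (κ - κ') * Real.exp (κ' * n) := by
    rw [h3]
    field_simp
  rw [h4]
  refine mul_le_mul_of_nonneg_right ?_ (Real.exp_pos _).le
  rw [le_div_iff₀ h2]
  linarith

/-- Only overlapping pairs contribute, and each is assigned to its union, again connected, whose
weight is at most the product of the two weights. If x lies in the union it lies in one of the two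
sets S; the partners meeting S cost a factor |S|, absorbed by `mul_exp_le`. The 4 is 2 for the
commutator times 2 for the choice of the set containing x. -/
theorem commutator_mem_localBall {κ κ' M M' : ℝ} (hκ : 0 ≤ κ') (h : κ' < κ) {O P : Obs Λ q}
    (hO : O ∈ localBall Λ q κ M) (hP : P ∈ localBall Λ q κ M') (hM : 0 ≤ M) (hM' : 0 ≤ M') :
    O * P - P * O ∈ localBall Λ q κ' (4 / (Real.exp 1 * (κ - κ')) * M * M') := by
  classical
  obtain ⟨Z, h1, h2, rfl⟩ := hO
  obtain ⟨W, h4, h5, rfl⟩ := hP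
  set c := 1 / (Real.exp 1 * (κ - κ')) with hc
  have hc0 : 0 ≤ c := by
    have := sub_pos.2 h
    positivity
  let R : Finset (Finset (Fin d → ℤ) × Finset (Fin d → ℤ)) :=
    (connSets Λ ×ˢ connSets Λ).filter fun p => ¬ Disjoint p.1 p.2
  let X : Finset (Fin d → ℤ) × Finset (Fin d → ℤ) → Obs Λ q :=
    fun p => Z p.1 * W p.2 - W p.2 * Z p.1
  have hR : ∀ p ∈ R, p.1 ∪ p.2 ∈ connSets Λ := fun p hp => by
    obtain ⟨hp1, hp2⟩ := Finset.mem_filter.1 hp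
    rw [Finset.mem_product] at hp1
    exact union_mem_connSets hp1.1 hp1.2 hp2
  refine ⟨fun S => ∑ p ∈ R.filter (fun p => p.1 ∪ p.2 = S), X p, fun S hS => ?_, fun x hx => ?_,
    ?_⟩
  · refine (actingWithin S).sum_mem fun p hp => ?_
    obtain ⟨hp1, rfl⟩ := Finset.mem_filter.1 hp
    have hp2 := Finset.mem_product.1 (Finset.mem_filter.1 hp1).1
    exact (h1 _ hp2.1).commutator (h4 _ hp2.2)
  · let a : Finset (Fin d → ℤ) → ℝ := fun S => Real.exp (κ' * S.card) * ‖Z S‖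
    let b : Finset (Fin d → ℤ) → ℝ := fun S => Real.exp (κ' * S.card) * ‖W S‖
    have ha0 : ∀ S, 0 ≤ a S := fun S => by positivity
    have hb0 : ∀ S, 0 ≤ b S := fun S => by positivity
    have hmono : ∀ Y : Finset (Fin d → ℤ) → Obs Λ q, ∀ S : Finset (Fin d → ℤ),
        Real.exp (κ' * S.card) * ‖Y S‖ ≤ Real.exp (κ * S.card) * ‖Y S‖ := fun Y S => by gcongr
    have ha : ∀ y ∈ Λ, ∑ S ∈ (connSets Λ).filter (fun S => y ∈ S), a S ≤ M := fun y hy =>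
      (Finset.sum_le_sum fun S _ => hmono Z S).trans (h2 y hy)
    have hb : ∀ y ∈ Λ, ∑ S ∈ (connSets Λ).filter (fun S => y ∈ S), b S ≤ M' := fun y hy =>
      (Finset.sum_le_sum fun S _ => hmono W S).trans (h5 y hy)
    have key : ∀ (Y : Finset (Fin d → ℤ) → Obs Λ q) (b : Finset (Fin d → ℤ) → ℝ) (M M' : ℝ),
        (∑ S ∈ (connSets Λ).filter (fun S => x ∈ S), Real.exp (κ * S.card) * ‖Y S‖ ≤ M) →
        0 ≤ M' → (∀ S, 0 ≤ b S) →
        (∀ y ∈ Λ, ∑ S ∈ (connSets Λ).filter (fun S => y ∈ S), b S ≤ M') →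
        ∑ S ∈ (connSets Λ).filter (fun S => x ∈ S), ∑ S' ∈ connSets Λ,
          (if Disjoint S S' then 0 else 2 * (Real.exp (κ' * S.card) * ‖Y S‖ * b S')) ≤
          2 * c * M * M' := by
      intro Y b M M' hY hM' hb0 hb
      calc ∑ S ∈ (connSets Λ).filter (fun S => x ∈ S), ∑ S' ∈ connSets Λ,
            (if Disjoint S S' then 0 else 2 * (Real.exp (κ' * S.card) * ‖Y S‖ * b S'))
          = ∑ S ∈ (connSets Λ).filter (fun S => x ∈ S), 2 * (Real.exp (κ' * S.card) * ‖Y S‖) *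
              ∑ S' ∈ connSets Λ, (if Disjoint S S' then 0 else b S') := by
            refine Finset.sum_congr rfl fun S _ => ?_
            rw [Finset.mul_sum]
            refine Finset.sum_congr rfl fun S' _ => ?_
            split_ifs <;> ring
        _ ≤ ∑ S ∈ (connSets Λ).filter (fun S => x ∈ S), 2 * (Real.exp (κ' * S.card) * ‖Y S‖) *
              (S.card * M') := by
            refine Finset.sum_le_sum fun S hS => ?_
            exact mul_le_mul_of_nonneg_left (sum_not_disjoint_le hb0 hb
              (mem_connSets.1 (Finset.mem_filter.1 hS).1).1) (by positivity)
        _ ≤ ∑ S ∈ (connSets Λ).filter (fun S => x ∈ S),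
              2 * c * M' * (Real.exp (κ * S.card) * ‖Y S‖) := by
            refine Finset.sum_le_sum fun S hS => ?_
            have := mul_exp_le h (S.card : ℝ)
            calc 2 * (Real.exp (κ' * S.card) * ‖Y S‖) * (S.card * M')
                = 2 * M' * ‖Y S‖ * (S.card * Real.exp (κ' * S.card)) := by ring
              _ ≤ 2 * M' * ‖Y S‖ * (c * Real.exp (κ * S.card)) := by gcongr
              _ = _ := by ring
        _ = 2 * c * M' * ∑ S ∈ (connSets Λ).filter (fun S => x ∈ S),
              (Real.exp (κ * S.card) * ‖Y S‖) := by rw [Finset.mul_sum]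
        _ ≤ 2 * c * M' * M := by gcongr
        _ = _ := by ring
    let w : Finset (Fin d → ℤ) × Finset (Fin d → ℤ) → ℝ := fun p => 2 * (a p.1 * b p.2)
    have hw0 : ∀ p, 0 ≤ w p := fun p => mul_nonneg zero_le_two (mul_nonneg (ha0 _) (hb0 _))
    have hterm : ∀ p, Real.exp (κ' * (p.1 ∪ p.2).card) * ‖X p‖ ≤ w p := fun p => by
      have h6 : ((p.1 ∪ p.2).card : ℝ) ≤ p.1.card + p.2.card := by
        exact_mod_cast Finset.card_union_le _ _
      calc Real.exp (κ' * (p.1 ∪ p.2).card) * ‖X p‖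
          ≤ Real.exp (κ' * (p.1.card + p.2.card)) * (2 * ‖Z p.1‖ * ‖W p.2‖) := by
            gcongr
            exact norm_commutator_le_two _ _
        _ = _ := by
            simp only [w, a, b]
            rw [mul_add, Real.exp_add]
            ring
    calc ∑ S ∈ (connSets Λ).filter (fun S => x ∈ S), Real.exp (κ' * S.card) *
          ‖∑ p ∈ R.filter (fun p => p.1 ∪ p.2 = S), X p‖
        ≤ ∑ S ∈ (connSets Λ).filter (fun S => x ∈ S),
            ∑ p ∈ R.filter (fun p => p.1 ∪ p.2 = S), (if x ∈ p.1 ∪ p.2 then w p else 0) := by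
          refine Finset.sum_le_sum fun S hS => ?_
          refine (mul_le_mul_of_nonneg_left (norm_sum_le _ _) (Real.exp_pos _).le).trans ?_
          rw [Finset.mul_sum]
          refine Finset.sum_le_sum fun p hp => ?_
          obtain ⟨_, rfl⟩ := Finset.mem_filter.1 hp
          rw [if_pos (Finset.mem_filter.1 hS).2]
          exact hterm p
      _ ≤ ∑ S ∈ connSets Λ,
            ∑ p ∈ R.filter (fun p => p.1 ∪ p.2 = S), (if x ∈ p.1 ∪ p.2 then w p else 0) := by
          refine Finset.sum_le_sum_of_subset_of_nonneg (Finset.filter_subset _ _)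
            fun S _ _ => Finset.sum_nonneg fun p _ => ?_
          split_ifs
          exacts [hw0 p, le_rfl]
      _ = ∑ p ∈ R, (if x ∈ p.1 ∪ p.2 then w p else 0) := Finset.sum_fiberwise_of_maps_to hR _
      _ ≤ ∑ p ∈ R, ((if x ∈ p.1 then w p else 0) + (if x ∈ p.2 then w p else 0)) := by
          refine Finset.sum_le_sum fun p _ => ?_
          have := hw0 p
          by_cases hx1 : x ∈ p.1 <;> by_cases hx2 : x ∈ p.2 <;> simp [hx1, hx2, this]
      _ = ∑ S ∈ (connSets Λ).filter (fun S => x ∈ S), ∑ S' ∈ connSets Λ,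
            (if Disjoint S S' then 0 else 2 * (Real.exp (κ' * S.card) * ‖Z S‖ * b S')) +
          ∑ S ∈ (connSets Λ).filter (fun S => x ∈ S), ∑ S' ∈ connSets Λ,
            (if Disjoint S S' then 0 else 2 * (Real.exp (κ' * S.card) * ‖W S‖ * a S')) := by
          rw [Finset.sum_add_distrib]
          simp only [R, Finset.sum_filter, Finset.sum_product]
          congr 1
          · refine Finset.sum_congr rfl fun S _ => ?_
            by_cases hx1 : x ∈ S
            · simp only [hx1, if_true]
              refine Finset.sum_congr rfl fun S' _ => ?_
              by_cases hd : Disjoint S S' <;> simp [hd, w, a]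
            · simp [hx1]
          · rw [Finset.sum_comm]
            refine Finset.sum_congr rfl fun S _ => ?_
            by_cases hx1 : x ∈ S
            · simp only [hx1, if_true]
              refine Finset.sum_congr rfl fun S' _ => ?_
              by_cases hd : Disjoint S S'
              · simp [hd, hd.symm]
              · have hd' : ¬ Disjoint S' S := fun h => hd h.symm
                rw [if_pos hd', if_neg hd]
                simp only [w, b]
                ring
            · simp [hx1]
      _ ≤ 2 * c * M * M' + 2 * c * M' * M :=
          add_le_add (key Z b M M' (h2 x hx) hM' hb0 hb) (key W a M' M (h5 x hx) hM ha0 ha)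
      _ = _ := by
          rw [hc]
          ring
  · rw [commutator_sum_eq h1 h4, Finset.sum_fiberwise_of_maps_to hR, Finset.sum_filter,
      Finset.sum_product]
    refine Finset.sum_congr rfl fun S _ => Finset.sum_congr rfl fun S' _ => ?_
    by_cases hd : Disjoint S S' <;> simp [hd, X]

end LocalBall

/-! ### Conjugation by an exponential as a series of nested commutators -/

section Conjugation

variable {𝔸 : Type*} [NormedRing 𝔸] [NormedAlgebra ℂ 𝔸] [CompleteSpace 𝔸]

open NormedSpace

theorem exp_mul_exp_neg (a : 𝔸) : exp a * exp (-a) = 1 := by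
  let _ : NormedAlgebra ℚ 𝔸 := NormedAlgebra.restrictScalars ℚ ℂ 𝔸
  rw [← exp_add_of_commute (Commute.refl a).neg_right, add_neg_cancel, exp_zero]

theorem exp_neg_mul_exp (a : 𝔸) : exp (-a) * exp a = 1 := by
  simpa using exp_mul_exp_neg (-a)

theorem continuous_exp_complex : Continuous (exp : 𝔸 → 𝔸) := by
  let _ : NormedAlgebra ℚ 𝔸 := NormedAlgebra.restrictScalars ℚ ℂ 𝔸
  exact exp_continuous

theorem exp_mulLeft_apply (a z : 𝔸) :
    exp (ContinuousLinearMap.mul ℂ 𝔸 a) z = exp a * z := by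
  have h1 := (exp_series_hasSum_exp' (𝕂 := ℂ) (ContinuousLinearMap.mul ℂ 𝔸 a)).mapL
    (ContinuousLinearMap.apply ℂ 𝔸 z)
  have h2 := (exp_series_hasSum_exp' (𝕂 := ℂ) a).mul_right z
  refine h1.unique (h2.congr_fun fun n => ?_)
  have h3 : ((ContinuousLinearMap.mul ℂ 𝔸 a) ^ n) z = a ^ n * z := by
    induction n with
    | zero => simp
    | succ k ih => rw [pow_succ', ContinuousLinearMap.mul_def, ContinuousLinearMap.comp_apply, ih]; simp [pow_succ', mul_assoc]
  simp [h3]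

theorem exp_mulRight_apply (a z : 𝔸) :
    exp ((ContinuousLinearMap.mul ℂ 𝔸).flip a) z = z * exp a := by
  have h1 := (exp_series_hasSum_exp' (𝕂 := ℂ) ((ContinuousLinearMap.mul ℂ 𝔸).flip a)).mapL
    (ContinuousLinearMap.apply ℂ 𝔸 z)
  have h2 := (exp_series_hasSum_exp' (𝕂 := ℂ) a).mul_left z
  refine h1.unique (h2.congr_fun fun n => ?_)
  have h3 : (((ContinuousLinearMap.mul ℂ 𝔸).flip a) ^ n) z = z * a ^ n := by
    induction n with
    | zero => simp
    | succ k ih => rw [pow_succ', ContinuousLinearMap.mul_def, ContinuousLinearMap.comp_apply, ih]; simp [pow_succ, mul_assoc]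
  simp [h3]

/-- Hadamard's formula `e^a z e^{-a} = ∑ (1/n!) ad_a^n z`. -/
theorem hasSum_exp_conj (a z : 𝔸) :
    HasSum (fun n : ℕ => ((n.factorial : ℂ)⁻¹) • (fun x => a * x - x * a)^[n] z)
      (exp a * z * exp (-a)) := by
  set l := ContinuousLinearMap.mul ℂ 𝔸 a
  set r := (ContinuousLinearMap.mul ℂ 𝔸).flip (-a)
  -- Left multiplication by a and right multiplication by -a commute and add up to ad_a, so
  -- exp(ad_a) factors into the two one-sided multiplications.
  have hc : Commute l r := by
    ext x
    simp [l, r, mul_assoc]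
  have h1 := (exp_series_hasSum_exp' (𝕂 := ℂ) (l + r)).mapL (ContinuousLinearMap.apply ℂ 𝔸 z)
  have h2 : exp (l + r) z = exp a * z * exp (-a) := by
    let _ : NormedAlgebra ℚ (𝔸 →L[ℂ] 𝔸) := NormedAlgebra.restrictScalars ℚ ℂ _
    rw [exp_add_of_commute hc, ContinuousLinearMap.mul_def, ContinuousLinearMap.comp_apply, exp_mulRight_apply,
      exp_mulLeft_apply, mul_assoc]
  rw [← h2]
  refine h1.congr_fun fun n => ?_
  have h3 : (((l + r) ^ n : 𝔸 →L[ℂ] 𝔸) z) = (fun x => a * x - x * a)^[n] z := by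
    induction n with
    | zero => simp
    | succ k ih =>
      rw [pow_succ', ContinuousLinearMap.mul_def, ContinuousLinearMap.comp_apply, ih, Function.iterate_succ_apply']
      simp [l, r, sub_eq_add_neg]
  simp [h3]

end Conjugation

/-! ### Locality of conjugated operators -/

section

variable {d : ℕ} {Λ : Finset (Fin d → ℤ)} {q : ℕ}

/-- The gap κ - κ' is divided evenly among n commutators, so that all of them have the same cost. -/
theorem iterate_commutator_mem_localBall {κ κ' M M' : ℝ} (hκ : 0 ≤ κ') (h : κ' < κ)
    {Q Z : Obs Λ q} (hQ : Q ∈ localBall Λ q κ M) (hZ : Z ∈ localBall Λ q κ M')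
    (hM : 0 ≤ M) (hM' : 0 ≤ M') {n : ℕ} (hn : 0 < n) {j : ℕ} (hj : j ≤ n) :
    (fun x => Q * x - x * Q)^[j] Z ∈ localBall Λ q (κ - j * ((κ - κ') / n))
      ((4 / (Real.exp 1 * ((κ - κ') / n)) * M) ^ j * M') := by
  have hn' : (0 : ℝ) < n := by exact_mod_cast hn
  have hδ : 0 < (κ - κ') / n := div_pos (sub_pos.2 h) hn'
  induction j with
  | zero => simpa using hZ
  | succ j ih =>
    have hj' : ((j : ℝ) + 1) * ((κ - κ') / n) ≤ κ - κ' := by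
      have : (j : ℝ) + 1 ≤ n := by exact_mod_cast hj
      calc ((j : ℝ) + 1) * ((κ - κ') / n) ≤ n * ((κ - κ') / n) := by gcongr
        _ = _ := by field_simp
    rw [Function.iterate_succ_apply']
    have := commutator_mem_localBall (κ := κ - j * ((κ - κ') / n))
      (κ' := κ - (j + 1 : ℕ) * ((κ - κ') / n)) (by push_cast; linarith) (by push_cast; linarith)
      (localBall_anti (sub_le_self _ (by positivity)) hQ) (ih (Nat.le_of_succ_le hj)) hM
      (by positivity)
    convert this using 1
    have h2 : κ - (j : ℝ) * ((κ - κ') / n) - (κ - ((j + 1 : ℕ) : ℝ) * ((κ - κ') / n)) =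
        (κ - κ') / n := by push_cast; ring
    rw [h2, pow_succ', mul_assoc, mul_assoc]

/-- Sharing the gap costs n^n/e^n, which 1/n! compensates because n^n/n! ≤ e^n. The series becomes
geometric. -/
theorem inv_factorial_smul_iterate_mem_localBall {κ κ' M M' : ℝ} (hκ : 0 ≤ κ') (h : κ' < κ)
    {Q Z : Obs Λ q} (hQ : Q ∈ localBall Λ q κ M) (hZ : Z ∈ localBall Λ q κ M')
    (hM : 0 ≤ M) (hM' : 0 ≤ M') (n : ℕ) :
    ((n.factorial : ℂ)⁻¹) • (fun x => Q * x - x * Q)^[n] Z ∈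
      localBall Λ q κ' ((4 * M / (κ - κ')) ^ n * M') := by
  have hδ : 0 < κ - κ' := sub_pos.2 h
  rcases Nat.eq_zero_or_pos n with rfl | hn
  · simpa using localBall_anti h.le hZ
  · have hn' : (0 : ℝ) < n := by exact_mod_cast hn
    have h1 := smul_mem_localBall ((n.factorial : ℂ)⁻¹)
      (iterate_commutator_mem_localBall hκ h hQ hZ hM hM' hn le_rfl)
    have h2 : κ - (n : ℝ) * ((κ - κ') / n) = κ' := by
      rw [mul_div_cancel₀ _ hn'.ne']
      ring
    rw [h2] at h1
    refine localBall_mono ?_ h1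
    have h3 := Real.pow_div_factorial_le_exp (n : ℝ) hn'.le n
    rw [norm_inv, Complex.norm_natCast, ← mul_assoc]
    refine mul_le_mul_of_nonneg_right ?_ hM'
    have h4 : 4 / (Real.exp 1 * ((κ - κ') / n)) * M =
        (4 * M / (κ - κ')) * (n / Real.exp 1) := by
      field_simp
    have h5 : Real.exp n = Real.exp 1 ^ n := by rw [← Real.exp_nat_mul, mul_one]
    rw [h4, mul_pow, div_pow (n : ℝ), ← h5]
    calc ((n.factorial : ℝ))⁻¹ * ((4 * M / (κ - κ')) ^ n * (n ^ n / Real.exp n))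
        = (4 * M / (κ - κ')) ^ n * ((n : ℝ) ^ n / n.factorial / Real.exp n) := by
          field_simp
      _ ≤ (4 * M / (κ - κ')) ^ n * 1 := by
          gcongr
          rw [div_le_one (Real.exp_pos _)]
          exact h3
      _ = _ := mul_one _

theorem sum_mem_localBall {κ : ℝ} {ι : Type*} (s : Finset ι) {f : ι → Obs Λ q} {b : ι → ℝ}
    (h : ∀ i ∈ s, f i ∈ localBall Λ q κ (b i)) :
    ∑ i ∈ s, f i ∈ localBall Λ q κ (∑ i ∈ s, b i) := by
  classical
  induction s using Finset.induction_on with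
  | empty => simpa using zero_mem_localBall le_rfl
  | insert i s hi ih =>
    rw [Finset.sum_insert hi, Finset.sum_insert hi]
    exact add_mem_localBall (h i (Finset.mem_insert_self _ _))
      (ih fun j hj => h j (Finset.mem_insert_of_mem hj))

/-- The series without its zeroth term is geometric with ratio 4M/(κ-κ') ≤ 1/2, so it is at most
twice its first term. Closedness of the ball passes the bound from partial sums to the limit. -/
theorem exp_conj_sub_mem_localBall {κ κ' M M' : ℝ} (hκ : 0 ≤ κ') (h : κ' < κ)
    {Q Z : Obs Λ q} (hQ : Q ∈ localBall Λ q κ M) (hZ : Z ∈ localBall Λ q κ M')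
    (hM : 0 ≤ M) (hM' : 0 ≤ M') (hs : 8 * M ≤ κ - κ') :
    NormedSpace.exp Q * Z * NormedSpace.exp (-Q) - Z ∈
      localBall Λ q κ' (8 * M / (κ - κ') * M') := by
  have hδ : 0 < κ - κ' := sub_pos.2 h
  have h1 := (hasSum_nat_add_iff' 1).2 (hasSum_exp_conj Q Z)
  simp only [Finset.range_one, Finset.sum_singleton, Nat.factorial_zero, Nat.cast_one, inv_one,
    one_smul, Function.iterate_zero_apply] at h1
  refine (isClosed_localBall hκ _).mem_of_tendsto h1.tendsto_sum_nat
    (Filter.Eventually.of_forall fun N => ?_)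
  refine localBall_mono ?_ (sum_mem_localBall _ fun n _ =>
    inv_factorial_smul_iterate_mem_localBall hκ h hQ hZ hM hM' (n + 1))
  set x := 4 * M / (κ - κ') with hx
  have hx0 : 0 ≤ x := by positivity
  have hx1 : x ≤ 1 / 2 := by
    rw [hx, div_le_iff₀ hδ]
    linarith
  rw [← Finset.sum_mul]
  refine mul_le_mul_of_nonneg_right ?_ hM'
  calc ∑ i ∈ Finset.range N, x ^ (i + 1) ≤ ∑ i ∈ Finset.range N, x * (1 / 2) ^ i := by
        refine Finset.sum_le_sum fun i _ => ?_
        rw [pow_succ']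
        gcongr
    _ = x * ∑ i ∈ Finset.range N, (1 / 2 : ℝ) ^ i := by rw [Finset.mul_sum]
    _ ≤ x * 2 := by
        gcongr
        exact sum_geometric_two_le N
    _ = _ := by rw [hx]; ring

end

/-! ### Regular time dependence and its preservation under rotation -/

section Regularity

variable {d : ℕ} {Λ : Finset (Fin d → ℤ)} {q : ℕ}

instance : ContinuousStar (Obs Λ q) :=
  ⟨(ContinuousLinearMap.adjoint (𝕜 := ℂ) (E := Hilb Λ q) (F := Hilb Λ q)).continuous⟩

theorem star_add_obs (A B : Obs Λ q) : star (A + B) = star A + star B :=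
  map_add (ContinuousLinearMap.adjoint (𝕜 := ℂ) (E := Hilb Λ q) (F := Hilb Λ q)) A B

theorem star_neg_obs (A : Obs Λ q) : star (-A) = -star A :=
  map_neg (ContinuousLinearMap.adjoint (𝕜 := ℂ) (E := Hilb Λ q) (F := Hilb Λ q)) A

theorem star_sub_obs (A B : Obs Λ q) : star (A - B) = star A - star B :=
  map_sub (ContinuousLinearMap.adjoint (𝕜 := ℂ) (E := Hilb Λ q) (F := Hilb Λ q)) A B

theorem smul_zero_obs (c : ℂ) : c • (0 : Obs Λ q) = 0 := by
  ext
  simp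

theorem neg_smul_obs (c : ℂ) (A : Obs Λ q) : -c • A = -(c • A) :=
  neg_smul c A

theorem star_real_smul (c : ℝ) (A : Obs Λ q) : star (c • A) = c • star A := by
  rw [← coe_smul_obs, star_smul, ← coe_smul_obs]
  simp

/-- The adjoint, as a real-linear map. -/
def starReal (Λ : Finset (Fin d → ℤ)) (q : ℕ) : Obs Λ q →L[ℝ] Obs Λ q where
  toFun := star
  map_add' := star_add_obs
  map_smul' := star_real_smul
  cont := continuous_star

theorem intervalIntegral_star {f : ℝ → Obs Λ q} {a b : ℝ} (hf : IntervalIntegrable f volume a b) :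
    star (∫ s in a..b, f s) = ∫ s in a..b, star (f s) :=
  ((starReal Λ q).intervalIntegral_comp_comm hf).symm

theorem continuous_exp_obs : Continuous (NormedSpace.exp : Obs Λ q → Obs Λ q) :=
  continuous_exp_complex

theorem star_exp_obs (A : Obs Λ q) : star (NormedSpace.exp A) = NormedSpace.exp (star A) :=
  NormedSpace.star_exp A

theorem exp_mem_unitary {A : Obs Λ q} (h : star A = -A) :
    NormedSpace.exp A ∈ unitary (Obs Λ q) := by
  rw [Unitary.mem_iff, star_exp_obs, h]
  exact ⟨exp_neg_mul_exp A, exp_mul_exp_neg A⟩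

theorem norm_exp_conj {A : Obs Λ q} (h : star A = -A) (Z : Obs Λ q) :
    ‖NormedSpace.exp (-A) * Z * NormedSpace.exp A‖ = ‖Z‖ := by
  rw [CStarRing.norm_mul_mem_unitary _ (exp_mem_unitary h),
    CStarRing.norm_mem_unitary_mul _ (exp_mem_unitary (by rw [star_neg_obs, h]))]

/-- Measurable, bounded, `T`-periodic and Hermitian time-dependent operators. -/
structure IsRegular (T : ℝ) (h : ℝ → Obs Λ q) : Prop where
  measurable : AEStronglyMeasurable h volume
  bounded : ∃ B : ℝ, ∀ t, ‖h t‖ ≤ B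
  periodic : Function.Periodic h T
  hermitian : ∀ t, star (h t) = h t

theorem locallyIntegrable_of_bounded {f : ℝ → Obs Λ q} (hf : AEStronglyMeasurable f volume)
    (hb : ∃ B : ℝ, ∀ t, ‖f t‖ ≤ B) : LocallyIntegrable f volume := by
  obtain ⟨B, hB⟩ := hb
  exact (locallyIntegrable_const B).mono hf (Filter.Eventually.of_forall fun t =>
    (hB t).trans (Real.le_norm_self B))

theorem IsRegular.locallyIntegrable {T : ℝ} {h : ℝ → Obs Λ q} (H : IsRegular T h) :
    LocallyIntegrable h volume :=
  locallyIntegrable_of_bounded H.measurable H.bounded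

theorem intervalIntegrable_of_locallyIntegrable {f : ℝ → Obs Λ q}
    (hf : LocallyIntegrable f volume) (a b : ℝ) : IntervalIntegrable f volume a b :=
  (hf.integrableOn_isCompact isCompact_uIcc).intervalIntegrable

theorem IsRegular.intervalIntegrable {T : ℝ} {h : ℝ → Obs Λ q} (H : IsRegular T h) (a b : ℝ) :
    IntervalIntegrable h volume a b :=
  intervalIntegrable_of_locallyIntegrable H.locallyIntegrable a b

theorem IsRegular.star_avg {T : ℝ} {h : ℝ → Obs Λ q} (H : IsRegular T h) :
    star (avg T h) = avg T h := by
  rw [avg, star_real_smul, intervalIntegral_star (H.intervalIntegrable _ _)]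
  simp only [H.hermitian]

theorem IsRegular.osc {T : ℝ} {h : ℝ → Obs Λ q} (H : IsRegular T h) : IsRegular T (osc T h) where
  measurable := H.measurable.sub aestronglyMeasurable_const
  bounded := by
    obtain ⟨B, hB⟩ := H.bounded
    exact ⟨B + ‖avg T h‖, fun t => (norm_sub_le _ _).trans (add_le_add_left (hB t) _)⟩
  periodic := fun t => by rw [SlowHeating.osc, SlowHeating.osc, H.periodic]
  hermitian := fun t => by rw [SlowHeating.osc, star_sub_obs, H.hermitian, H.star_avg]

theorem IsRegular.integral_osc {T : ℝ} (hT : 0 < T) {h : ℝ → Obs Λ q} (H : IsRegular T h) :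
    ∫ t in (0 : ℝ)..T, SlowHeating.osc T h t = 0 := by
  simp only [SlowHeating.osc]
  rw [intervalIntegral.integral_sub (H.intervalIntegrable _ _) (by simp),
    intervalIntegral.integral_const, avg, sub_zero, smul_smul, mul_one_div_cancel hT.ne', one_smul,
    sub_self]

theorem IsRegular.integral_osc_period {T : ℝ} (hT : 0 < T) {h : ℝ → Obs Λ q}
    (H : IsRegular T h) (t : ℝ) : ∫ s in t..t + T, SlowHeating.osc T h s = 0 := by
  rw [H.osc.periodic.intervalIntegral_add_eq t 0, zero_add, H.integral_osc hT]

/-- The oscillating part has mean zero over every period. -/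
theorem IsRegular.rotGen_periodic {T : ℝ} (hT : 0 < T) {h : ℝ → Obs Λ q} (H : IsRegular T h) :
    Function.Periodic (rotGen T h) T := fun t => by
  rw [rotGen, rotGen, H.osc.periodic.intervalIntegral_add_eq_add 0 t H.osc.intervalIntegrable,
    H.integral_osc_period hT, add_zero]

theorem rotGen_zero {T : ℝ} (h : ℝ → Obs Λ q) : rotGen T h 0 = 0 := by
  rw [rotGen, intervalIntegral.integral_same]
  rw [smul_zero_obs, neg_zero]

theorem IsRegular.rotGen_nat_mul {T : ℝ} (hT : 0 < T) {h : ℝ → Obs Λ q} (H : IsRegular T h)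
    (m : ℕ) : rotGen T h (m * T) = 0 := by
  rw [(H.rotGen_periodic hT).nat_mul_eq, rotGen_zero]

theorem IsRegular.star_rotGen {T : ℝ} {h : ℝ → Obs Λ q} (H : IsRegular T h) (t : ℝ) :
    star (rotGen T h t) = -rotGen T h t := by
  rw [rotGen, star_neg_obs, star_smul, intervalIntegral_star (H.osc.intervalIntegrable _ _)]
  simp only [H.osc.hermitian]
  rw [Complex.star_def, Complex.conj_I, neg_smul_obs]

theorem integral_mem_smul_convex {s : Set (Obs Λ q)} (hs : Convex ℝ s) (hc : IsClosed s) {a b : ℝ}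
    (hab : a < b) {f : ℝ → Obs Λ q} (hf : ∀ t ∈ Set.Ioc a b, f t ∈ s)
    (hi : IntervalIntegrable f volume a b) :
    (b - a)⁻¹ • ∫ t in a..b, f t ∈ s := by
  rw [← interval_average_eq, Set.uIoc_of_le hab.le]
  refine hs.set_average_mem hc ?_ ?_
    ((ae_restrict_mem measurableSet_Ioc).mono fun t ht => hf t ht) hi.1
  · simp [hab]
  · simp

theorem integral_mem_localBall {κ M : ℝ} (hκ : 0 ≤ κ) {a b : ℝ} (hab : a ≤ b) {f : ℝ → Obs Λ q}
    (hf : ∀ t ∈ Set.Ioc a b, f t ∈ localBall Λ q κ M) (hi : IntervalIntegrable f volume a b) :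
    ∫ t in a..b, f t ∈ localBall Λ q κ ((b - a) * M) := by
  rcases hab.eq_or_lt with rfl | hab
  · simpa using zero_mem_localBall le_rfl
  · have h1 := real_smul_mem_localBall (b - a)
      (integral_mem_smul_convex (convex_localBall κ M) (isClosed_localBall hκ M) hab hf hi)
    rwa [smul_smul, mul_inv_cancel₀ (sub_pos.2 hab).ne', one_smul,
      abs_of_pos (sub_pos.2 hab)] at h1

/-- By periodicity t may be taken in [0, T), which makes the bound uniform in time. -/
theorem IsRegular.rotGen_mem_localBall {κ M T : ℝ} (hκ : 0 ≤ κ) (hM : 0 ≤ M) (hT : 0 < T)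
    {h : ℝ → Obs Λ q} (H : IsRegular T h) (hV : ∀ t, SlowHeating.osc T h t ∈ localBall Λ q κ M)
    (t : ℝ) : rotGen T h t ∈ localBall Λ q κ (T * M) := by
  obtain ⟨s, hs, hst⟩ := (H.rotGen_periodic hT).exists_mem_Ico₀ hT t
  rw [hst, rotGen]
  have h1 := smul_mem_localBall Complex.I
    (integral_mem_localBall hκ hs.1 (fun t _ => hV t) (H.osc.intervalIntegrable 0 s))
  rw [Complex.norm_I, one_mul, sub_zero] at h1
  exact neg_mem_localBall (localBall_mono (mul_le_mul_of_nonneg_right hs.2.le hM) h1)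

theorem IsRegular.continuous_rotGen {T : ℝ} {h : ℝ → Obs Λ q} (H : IsRegular T h) :
    Continuous (rotGen T h) := by
  have := intervalIntegral.continuous_primitive H.osc.intervalIntegrable 0
  unfold rotGen
  exact (this.const_smul Complex.I).neg

theorem continuous_integral_exp_conj :
    Continuous fun p : Obs Λ q × Obs Λ q => ∫ s in (0 : ℝ)..1,
      NormedSpace.exp (-(s • p.1)) * p.2 * NormedSpace.exp (s • p.1) := by
  refine intervalIntegral.continuous_parametric_intervalIntegral_of_continuous' ?_ 0 1
  have h1 : Continuous fun p : (Obs Λ q × Obs Λ q) × ℝ => p.2 • p.1.1 :=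
    continuous_snd.smul continuous_fst.fst
  exact ((continuous_exp_obs.comp h1.neg).mul continuous_fst.snd).mul (continuous_exp_obs.comp h1)

theorem continuous_exp_conj (A Z : Obs Λ q) : Continuous fun s : ℝ =>
    NormedSpace.exp (-(s • A)) * Z * NormedSpace.exp (s • A) := by
  have h1 : Continuous fun s : ℝ => s • A := continuous_id.smul continuous_const
  exact ((continuous_exp_obs.comp h1.neg).mul continuous_const).mul (continuous_exp_obs.comp h1)

theorem comp_pair_aestronglyMeasurable {f g : ℝ → Obs Λ q}
    (hf : AEStronglyMeasurable f volume) (hg : AEStronglyMeasurable g volume)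
    {F : Obs Λ q × Obs Λ q → Obs Λ q} (hF : Continuous F) :
    AEStronglyMeasurable (fun t => F (f t, g t)) volume :=
  hF.comp_aestronglyMeasurable (hf.prodMk hg)

theorem continuous_conj_exp : Continuous fun p : Obs Λ q × Obs Λ q =>
    NormedSpace.exp (-p.1) * p.2 * NormedSpace.exp p.1 := by
  have h1 : Continuous fun p : Obs Λ q × Obs Λ q => -p.1 := continuous_fst.neg
  have h2 := continuous_exp_obs.comp h1
  have h3 := (continuous_exp_obs (Λ := Λ) (q := q)).comp
    (continuous_fst (X := Obs Λ q) (Y := Obs Λ q))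
  exact (h2.mul continuous_snd).mul h3

theorem IsRegular.measurable_rotate {T : ℝ} {h : ℝ → Obs Λ q} (H : IsRegular T h) :
    AEStronglyMeasurable (SlowHeating.rotate T h) volume := by
  have hA := H.continuous_rotGen.aestronglyMeasurable (μ := volume)
  have h1 := comp_pair_aestronglyMeasurable hA H.measurable continuous_conj_exp
  have h2 := comp_pair_aestronglyMeasurable hA H.osc.measurable
    continuous_integral_exp_conj
  exact h1.sub h2

theorem IsRegular.rotate {T : ℝ} (hT : 0 < T) {h : ℝ → Obs Λ q} (H : IsRegular T h) :
    IsRegular T (rotate T h) where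
  measurable := H.measurable_rotate
  bounded := by
    obtain ⟨B, hB⟩ := H.bounded
    obtain ⟨B', hB'⟩ := H.osc.bounded
    refine ⟨B + B' * |1 - 0|, fun t => (norm_sub_le _ _).trans (add_le_add ?_ ?_)⟩
    · rw [norm_exp_conj (H.star_rotGen t)]
      exact hB t
    · refine intervalIntegral.norm_integral_le_of_norm_le_const fun s _ => ?_
      rw [norm_exp_conj (by rw [star_real_smul, H.star_rotGen, smul_neg])]
      exact hB' t
  periodic := fun t => by
    rw [SlowHeating.rotate, SlowHeating.rotate, H.rotGen_periodic hT, H.periodic, H.osc.periodic]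
  hermitian := fun t => by
    rw [SlowHeating.rotate, star_sub_obs,
      intervalIntegral_star ((continuous_exp_conj _ _).intervalIntegrable _ _)]
    simp only [star_mul, star_exp_obs, star_neg_obs, star_real_smul, H.star_rotGen, H.hermitian,
      H.osc.hermitian, smul_neg, neg_neg, mul_assoc]

theorem IsRegular.renHam {T : ℝ} (hT : 0 < T) {h : ℝ → Obs Λ q} (H : IsRegular T h) (k : ℕ) :
    IsRegular T (renHam T h k) := by
  induction k with
  | zero => exact H
  | succ k ih => exact ih.rotate hT

end Regularity

/-! ### Evolution equations almost everywhere -/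

section Dynamics

variable {d : ℕ} {Λ : Finset (Fin d → ℤ)} {q : ℕ}

theorem hasDerivAt_mul_obs {f g : ℝ → Obs Λ q} {f' g' : Obs Λ q} {t : ℝ}
    (hf : HasDerivAt f f' t) (hg : HasDerivAt g g' t) :
    HasDerivAt (fun s => f s * g s) (f' * g t + f t * g') t :=
  HasDerivAt.mul hf hg

theorem hasDerivAt_star_obs {f : ℝ → Obs Λ q} {f' : Obs Λ q} {t : ℝ} (hf : HasDerivAt f f' t) :
    HasDerivAt (fun s => star (f s)) (star f') t :=
  (starReal Λ q).hasFDerivAt.comp_hasDerivAt t hf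

theorem hasDerivAt_exp_smul_obs (A : Obs Λ q) (s : ℝ) :
    HasDerivAt (fun u : ℝ => NormedSpace.exp (u • A)) (A * NormedSpace.exp (s • A)) s :=
  hasDerivAt_exp_smul_const' A s

theorem hasDerivAt_exp_smul_obs' (A : Obs Λ q) (s : ℝ) :
    HasDerivAt (fun u : ℝ => NormedSpace.exp (u • A)) (NormedSpace.exp (s • A) * A) s :=
  hasDerivAt_exp_smul_const A s

theorem locallyLipschitz_mul {𝔸 : Type*} [NormedRing 𝔸] [NormedAlgebra ℂ 𝔸] {f g : ℝ → 𝔸}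
    (hf : LocallyLipschitz f) (hg : LocallyLipschitz g) :
    LocallyLipschitz fun t => f t * g t := by
  have h : LocallyLipschitz fun p : 𝔸 × 𝔸 => p.1 * p.2 :=
    (contDiff_mul (𝕜 := ℂ) (n := 1)).locallyLipschitz
  have := h.comp (hf.prodMk hg)
  exact this

theorem locallyLipschitz_star_obs {f : ℝ → Obs Λ q} (hf : LocallyLipschitz f) :
    LocallyLipschitz fun t => star (f t) :=
  (starReal Λ q).lipschitz.locallyLipschitz.comp hf

theorem locallyLipschitz_exp_obs {f : ℝ → Obs Λ q} (hf : LocallyLipschitz f) :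
    LocallyLipschitz fun t => NormedSpace.exp (f t) := by
  have h : ContDiff ℂ 1 (NormedSpace.exp : Obs Λ q → Obs Λ q) :=
    contDiff_iff_contDiffAt.2 fun x => (NormedSpace.exp_analytic (𝕂 := ℂ) x).contDiffAt
  exact h.locallyLipschitz.comp hf

theorem locallyIntegrable_of_locally_bounded {f : ℝ → Obs Λ q}
    (hf : AEStronglyMeasurable f volume)
    (hb : ∀ x, ∃ B : ℝ, ∀ t ∈ Set.Icc (x - 1) (x + 1), ‖f t‖ ≤ B) :
    LocallyIntegrable f volume := by
  intro x
  obtain ⟨B, hB⟩ := hb x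
  refine ⟨Set.Icc (x - 1) (x + 1), Icc_mem_nhds (by linarith) (by linarith), ?_⟩
  refine IntegrableOn.of_bound (by simp) hf.restrict B ?_
  filter_upwards [ae_restrict_mem measurableSet_Icc] with t ht
  exact hB t ht

theorem locallyLipschitz_primitive {f : ℝ → Obs Λ q} (hf : AEStronglyMeasurable f volume)
    (hb : ∀ x, ∃ B : ℝ, ∀ t ∈ Set.Icc (x - 1) (x + 1), ‖f t‖ ≤ B) (a : ℝ) :
    LocallyLipschitz fun t => ∫ s in a..t, f s := by
  have hi := intervalIntegrable_of_locallyIntegrable (locallyIntegrable_of_locally_bounded hf hb)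
  intro x
  obtain ⟨B, hB⟩ := hb x
  refine ⟨B.toNNReal, Set.Icc (x - 1) (x + 1), Icc_mem_nhds (by linarith) (by linarith), ?_⟩
  refine LipschitzOnWith.of_dist_le_mul fun s hs t ht => ?_
  rw [dist_eq_norm, intervalIntegral.integral_interval_sub_left (hi _ _) (hi _ _), Real.dist_eq]
  refine intervalIntegral.norm_integral_le_of_norm_le_const fun u hu => ?_
  refine (hB u ?_).trans (Real.le_coe_toNNReal B)
  have := Set.uIoc_subset_uIcc hu
  exact Set.uIcc_subset_Icc ht hs this

/-- Local Lipschitz continuity gives absolute continuity on compact intervals; a derivative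
vanishing almost everywhere would not suffice alone. -/
theorem eq_of_ae_hasDerivAt_zero {F : ℝ → Obs Λ q} (hF : LocallyLipschitz F)
    (h0 : ∀ᵐ t, HasDerivAt F 0 t) (a b : ℝ) : F b = F a := by
  obtain ⟨K, hK⟩ := (hF.locallyLipschitzOn (s := Set.uIcc a b)).exists_lipschitzOnWith_of_compact
    isCompact_uIcc
  obtain ⟨C, hC⟩ := hK.absolutelyContinuousOnInterval.const_of_ae_hasDerivAt_zero
    (h0.mono fun t ht _ => ht)
  rw [hC a Set.left_mem_uIcc, hC b Set.right_mem_uIcc]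

theorem norm_sub_le_of_ae_hasDerivAt {F f : ℝ → Obs Λ q} (hF : LocallyLipschitz F)
    (hf : AEStronglyMeasurable f volume) (h : ∀ᵐ t, HasDerivAt F (f t) t) {B : ℝ}
    (hB : ∀ t, ‖f t‖ ≤ B) {a b : ℝ} (hab : a ≤ b) : ‖F b - F a‖ ≤ (b - a) * B := by
  have h1 := locallyLipschitz_primitive hf (fun _ => ⟨B, fun t _ => hB t⟩) a
  have h2 := LocallyIntegrable.ae_hasDerivAt_integral (locallyIntegrable_of_bounded hf ⟨B, hB⟩)
  have h3 : ∀ᵐ t, HasDerivAt (fun t => F t - ∫ s in a..t, f s) 0 t := by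
    filter_upwards [h, h2] with t ht ht2
    have := ht.sub (ht2 a)
    rwa [sub_self] at this
  have h4 := eq_of_ae_hasDerivAt_zero (hF.sub h1) h3 a b
  rw [intervalIntegral.integral_same, sub_zero] at h4
  rw [← h4, sub_sub_cancel]
  refine (intervalIntegral.norm_integral_le_of_norm_le_const fun u _ => hB u).trans (le_of_eq ?_)
  rw [abs_of_nonneg (sub_nonneg.2 hab), mul_comm]

/-- `U` solves `∂_t U = -i h U`, `U(0) = 1`, in the sense of locally Lipschitz functions. -/
structure IsEvolution (h U : ℝ → Obs Λ q) : Prop where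
  locallyLipschitz : LocallyLipschitz U
  hasDerivAt : ∀ᵐ t, HasDerivAt U (-(Complex.I • (h t * U t))) t
  zero : U 0 = 1

theorem IsPropagator.isEvolution {T : ℝ} {h U : ℝ → Obs Λ q} (H : IsRegular T h)
    (hU : IsPropagator h U) : IsEvolution h U := by
  obtain ⟨hc, hU⟩ := hU
  have hm : AEStronglyMeasurable (fun t => h t * U t) volume :=
    comp_pair_aestronglyMeasurable H.measurable hc.aestronglyMeasurable
      (F := fun p => p.1 * p.2) continuous_mul
  have hb : ∀ x, ∃ B : ℝ, ∀ t ∈ Set.Icc (x - 1) (x + 1), ‖h t * U t‖ ≤ B := fun x => by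
    obtain ⟨B, hB⟩ := H.bounded
    obtain ⟨C, hC⟩ := (isCompact_Icc (a := x - 1) (b := x + 1)).exists_bound_of_continuousOn
      hc.continuousOn
    refine ⟨B * C, fun t ht => (norm_mul_le _ _).trans ?_⟩
    have := hB t
    have := hC t ht
    have := norm_nonneg (h t)
    gcongr
    linarith
  have hUeq : U = fun t => 1 - Complex.I • ∫ s in (0 : ℝ)..t, h s * U s := funext hU
  have h1 := locallyLipschitz_primitive hm hb 0
  refine ⟨?_, ?_, ?_⟩
  -- Multiplication by i is written as a product with the constant i·1, so that the product rule for
  -- Lipschitz functions applies.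
  · have h2 := locallyLipschitz_mul (LocallyLipschitz.const (Complex.I • (1 : Obs Λ q))) h1
    have h3 := (LocallyLipschitz.const (1 : Obs Λ q)).sub h2
    have h4 : ∀ A : Obs Λ q, (Complex.I • (1 : Obs Λ q)) * A = Complex.I • A := fun A => by
      rw [smul_mul_assoc, one_mul]
    simp only [h4] at h3
    rw [hUeq]
    exact h3
  · have h2 := LocallyIntegrable.ae_hasDerivAt_integral (locallyIntegrable_of_locally_bounded hm hb)
    filter_upwards [h2] with t ht
    have h3 := ((ht 0).const_smul Complex.I).const_sub (1 : Obs Λ q)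
    exact h3.congr_of_eventuallyEq (Filter.Eventually.of_forall hU)
  · rw [hU, intervalIntegral.integral_same, smul_zero_obs, sub_zero]

theorem norm_one_obs_le : ‖(1 : Obs Λ q)‖ ≤ 1 :=
  ContinuousLinearMap.norm_id_le

theorem star_I_smul (A : Obs Λ q) : star (-(Complex.I • A)) = Complex.I • star A := by
  rw [star_neg_obs, star_smul, Complex.star_def, Complex.conj_I, neg_smul_obs, neg_neg]

theorem I_smul_conj_commutator {𝔸 : Type*} [Ring 𝔸] [Algebra ℂ 𝔸] (s h D u : 𝔸) :
    Complex.I • (s * (h * D - D * h) * u) =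
      ((Complex.I • (s * h)) * D + s * 0) * u + s * D * -(Complex.I • (h * u)) := by
  simp only [mul_zero, add_zero, mul_neg, smul_mul_assoc, mul_smul_comm, mul_sub, sub_mul,
    smul_sub, mul_assoc]
  rw [sub_eq_add_neg]

theorem IsEvolution.hasDerivAt_conj {T : ℝ} {h U : ℝ → Obs Λ q} (H : IsRegular T h)
    (E : IsEvolution h U) (D : Obs Λ q) : ∀ᵐ t, HasDerivAt (fun t => star (U t) * D * U t)
      (Complex.I • (star (U t) * (h t * D - D * h t) * U t)) t := by
  filter_upwards [E.hasDerivAt] with t ht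
  have h1 := hasDerivAt_mul_obs (hasDerivAt_mul_obs (hasDerivAt_star_obs ht)
    (hasDerivAt_const t D)) ht
  convert h1 using 1
  rw [star_I_smul, star_mul, H.hermitian]
  exact I_smul_conj_commutator _ _ _ _

theorem IsEvolution.locallyLipschitz_conj {h U : ℝ → Obs Λ q}
    (E : IsEvolution h U) (D : Obs Λ q) : LocallyLipschitz fun t => star (U t) * D * U t :=
  locallyLipschitz_mul (locallyLipschitz_mul (locallyLipschitz_star_obs E.locallyLipschitz)
    (LocallyLipschitz.const D)) E.locallyLipschitz

/-- The Heisenberg equation for the identity: the commutator vanishes. -/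
theorem IsEvolution.star_mul_self {T : ℝ} {h U : ℝ → Obs Λ q} (H : IsRegular T h)
    (E : IsEvolution h U) (t : ℝ) : star (U t) * U t = 1 := by
  have h1 := eq_of_ae_hasDerivAt_zero (E.locallyLipschitz_conj 1) (by
    filter_upwards [E.hasDerivAt_conj H 1] with t ht
    rwa [mul_one, one_mul, sub_self, mul_zero, zero_mul, smul_zero_obs] at ht) 0 t
  rw [mul_one, mul_one, E.zero, star_one, mul_one] at h1
  exact h1

theorem IsEvolution.norm_le_one {T : ℝ} {h U : ℝ → Obs Λ q} (H : IsRegular T h)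
    (E : IsEvolution h U) (t : ℝ) : ‖U t‖ ≤ 1 := by
  have h1 : ‖U t‖ * ‖U t‖ ≤ 1 := by
    rw [← CStarRing.norm_star_mul_self, E.star_mul_self H]
    exact norm_one_obs_le
  nlinarith [norm_nonneg (U t)]

theorem IsEvolution.norm_conj_le {T : ℝ} {h U : ℝ → Obs Λ q} (H : IsRegular T h)
    (E : IsEvolution h U) (t : ℝ) (Z : Obs Λ q) : ‖star (U t) * Z * U t‖ ≤ ‖Z‖ := by
  have h1 := E.norm_le_one H t
  have h2 : ‖star (U t)‖ ≤ 1 := (norm_star (U t)).trans_le h1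
  calc ‖star (U t) * Z * U t‖ ≤ ‖star (U t) * Z‖ * ‖U t‖ := norm_mul_le _ _
    _ ≤ ‖star (U t)‖ * ‖Z‖ * ‖U t‖ := by gcongr; exact norm_mul_le _ _
    _ ≤ 1 * ‖Z‖ * 1 := by gcongr
    _ = ‖Z‖ := by ring

theorem IsEvolution.norm_conj_sub_le {T : ℝ} {h U : ℝ → Obs Λ q} (H : IsRegular T h)
    (E : IsEvolution h U) {D : Obs Λ q} {B : ℝ} (hB : ∀ t, ‖h t * D - D * h t‖ ≤ B) {a b : ℝ}
    (hab : a ≤ b) :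
    ‖star (U b) * D * U b - star (U a) * D * U a‖ ≤ (b - a) * B := by
  have hc : Continuous fun p : Obs Λ q × Obs Λ q =>
      star p.2 * (p.1 * D - D * p.1) * p.2 := by
    have h1 : Continuous fun p : Obs Λ q × Obs Λ q => star p.2 :=
      continuous_star.comp continuous_snd
    have h2 : Continuous fun p : Obs Λ q × Obs Λ q => p.1 * D :=
      continuous_fst.mul continuous_const
    have h3 : Continuous fun p : Obs Λ q × Obs Λ q => D * p.1 :=
      continuous_const.mul continuous_fst
    exact (h1.mul (h2.sub h3)).mul continuous_snd
  have hm := comp_pair_aestronglyMeasurable H.measurable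
    E.locallyLipschitz.continuous.aestronglyMeasurable hc
  have hm' : AEStronglyMeasurable
      (fun t => Complex.I • (star (U t) * (h t * D - D * h t) * U t)) volume :=
    AEStronglyMeasurable.const_smul hm Complex.I
  refine norm_sub_le_of_ae_hasDerivAt (E.locallyLipschitz_conj D) hm' (E.hasDerivAt_conj H D)
    (fun t => ?_) hab
  have h1 := (E.norm_conj_le H t (h t * D - D * h t)).trans (hB t)
  calc ‖Complex.I • (star (U t) * (h t * D - D * h t) * U t)‖
      = ‖star (U t) * (h t * D - D * h t) * U t‖ := by rw [norm_smul, Complex.norm_I, one_mul]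
    _ ≤ B := h1

end Dynamics

/-! ### Duhamel's formula and the change of frame -/

section Frame

variable {d : ℕ} {Λ : Finset (Fin d → ℤ)} {q : ℕ}

theorem zero_smul_obs (X : Obs Λ q) : (0 : ℝ) • X = 0 :=
  zero_smul ℝ X

theorem one_smul_obs (X : Obs Λ q) : (1 : ℝ) • X = X :=
  one_smul ℝ X

theorem exp_one_sub_smul_mul_exp_neg {𝔸 : Type*} [NormedRing 𝔸] [NormedAlgebra ℂ 𝔸]
    [CompleteSpace 𝔸] (c : ℂ) (X : 𝔸) :
    NormedSpace.exp ((1 - c) • X) * NormedSpace.exp (-X) = NormedSpace.exp (c • -X) := by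
  let _ : NormedAlgebra ℚ 𝔸 := NormedAlgebra.restrictScalars ℚ ℂ 𝔸
  have hc : Commute ((1 - c) • X) (-X) := ((Commute.refl X).smul_left (1 - c)).neg_right
  rw [← NormedSpace.exp_add_of_commute hc]
  congr 1
  module

theorem exp_smul_mul_exp_neg (s : ℝ) (X : Obs Λ q) :
    NormedSpace.exp ((1 - s) • X) * NormedSpace.exp (-X) = NormedSpace.exp (s • -X) := by
  have h := exp_one_sub_smul_mul_exp_neg (s : ℂ) X
  rw [← coe_smul_obs, ← coe_smul_obs]
  push_cast
  exact h

theorem mul_sub_mul_eq {𝔸 : Type*} [Ring 𝔸] (e f X Y : 𝔸) :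
    e * (Y - X) * f = -(e * X) * f + e * (Y * f) := by
  noncomm_ring

theorem hasDerivAt_exp_one_sub_smul (X : Obs Λ q) (s : ℝ) :
    HasDerivAt (fun u : ℝ => NormedSpace.exp ((1 - u) • X))
      (-(NormedSpace.exp ((1 - s) • X) * X)) s := by
  have h1 := (hasDerivAt_exp_smul_obs' X (1 - s)).comp_const_sub 1 s
  exact h1

theorem continuous_smul_exp (X : Obs Λ q) {f : ℝ → ℝ} (hf : Continuous f) :
    Continuous fun s : ℝ => NormedSpace.exp (f s • X) :=
  continuous_exp_obs.comp (hf.smul continuous_const)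

/-- Fundamental theorem of calculus along e^{(1-s)X} e^{sY}. Unlike a differentiated power series,
it yields the derivative of e^{A(t)} for noncommuting values of A. -/
theorem exp_sub_exp_eq_integral (X Y : Obs Λ q) :
    NormedSpace.exp Y - NormedSpace.exp X =
      ∫ s in (0 : ℝ)..1, NormedSpace.exp ((1 - s) • X) * (Y - X) * NormedSpace.exp (s • Y) := by
  have h1 : ∀ s : ℝ, HasDerivAt
      (fun u : ℝ => NormedSpace.exp ((1 - u) • X) * NormedSpace.exp (u • Y))
      (NormedSpace.exp ((1 - s) • X) * (Y - X) * NormedSpace.exp (s • Y)) s := fun s => by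
    have := hasDerivAt_mul_obs (hasDerivAt_exp_one_sub_smul X s) (hasDerivAt_exp_smul_obs Y s)
    convert this using 1
    exact mul_sub_mul_eq _ _ _ _
  have h2 : Continuous fun s : ℝ =>
      NormedSpace.exp ((1 - s) • X) * (Y - X) * NormedSpace.exp (s • Y) :=
    ((continuous_smul_exp X (continuous_const.sub continuous_id)).mul continuous_const).mul
      (continuous_smul_exp Y continuous_id)
  rw [intervalIntegral.integral_eq_sub_of_hasDerivAt (fun s _ => h1 s) (h2.intervalIntegrable 0 1)]
  simp only [sub_self, sub_zero, one_smul_obs, zero_smul_obs, NormedSpace.exp_zero, one_mul,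
    mul_one]

theorem continuous_duhamel (X : Obs Λ q) :
    Continuous fun p : Obs Λ q × Obs Λ q => ∫ s in (0 : ℝ)..1,
      NormedSpace.exp ((1 - s) • X) * p.1 * NormedSpace.exp (s • p.2) := by
  refine intervalIntegral.continuous_parametric_intervalIntegral_of_continuous' ?_ 0 1
  have h1 : Continuous fun p : (Obs Λ q × Obs Λ q) × ℝ => p.2 • p.1.2 :=
    continuous_snd.smul continuous_fst.snd
  have h2 : Continuous fun p : (Obs Λ q × Obs Λ q) × ℝ => NormedSpace.exp ((1 - p.2) • X) :=
    (continuous_smul_exp X (continuous_const.sub continuous_id)).comp continuous_snd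
  exact (h2.mul continuous_fst.fst).mul (continuous_exp_obs.comp h1)

theorem hasDerivAt_exp_obs {A : ℝ → Obs Λ q} {A' : Obs Λ q} {t : ℝ} (hA : HasDerivAt A A' t) :
    HasDerivAt (fun s => NormedSpace.exp (A s))
      (∫ s in (0 : ℝ)..1, NormedSpace.exp ((1 - s) • A t) * A' * NormedSpace.exp (s • A t)) t := by
  rw [hasDerivAt_iff_tendsto_slope] at hA ⊢
  have h1 : Filter.Tendsto A (nhdsWithin t {t}ᶜ) (nhds (A t)) := by
    have := (hasDerivAt_iff_tendsto_slope.2 hA).continuousAt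
    exact this.tendsto.mono_left nhdsWithin_le_nhds
  have h2 := ((continuous_duhamel (A t)).tendsto (A', A t)).comp (hA.prodMk_nhds h1)
  refine h2.congr fun u => ?_
  rw [Function.comp_apply, slope_def_module, slope_def_module, exp_sub_exp_eq_integral,
    ← intervalIntegral.integral_smul]
  simp only [mul_smul_comm, smul_mul_assoc]

theorem integral_exp_one_sub (A B : Obs Λ q) :
    ∫ s in (0 : ℝ)..1, NormedSpace.exp ((1 - s) • -A) * B * NormedSpace.exp (s • -A) =
      (∫ s in (0 : ℝ)..1, NormedSpace.exp (-(s • A)) * B * NormedSpace.exp (s • A)) *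
        NormedSpace.exp (-A) := by
  have h1 := intervalIntegral.integral_comp_sub_left (a := 0) (b := 1)
    (fun s : ℝ => NormedSpace.exp (-(s • A)) * B * NormedSpace.exp (s • A)) 1
  rw [sub_self, sub_zero] at h1
  rw [← h1]
  have h3 : ∀ Z : Obs Λ q, (ContinuousLinearMap.mul ℂ (Obs Λ q)).flip (NormedSpace.exp (-A)) Z =
    Z * NormedSpace.exp (-A) := fun Z => rfl
  have hc : Continuous fun s : ℝ =>
      NormedSpace.exp (-((1 - s) • A)) * B * NormedSpace.exp ((1 - s) • A) :=
    (continuous_exp_conj A B).comp (continuous_const.sub continuous_id)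
  have h2 := ((ContinuousLinearMap.mul ℂ (Obs Λ q)).flip
    (NormedSpace.exp (-A))).intervalIntegral_comp_comm (hc.intervalIntegrable (μ := volume) 0 1)
  simp only [h3] at h2
  rw [← h2]
  refine intervalIntegral.integral_congr fun s _ => ?_
  rw [smul_neg (1 - s) A, mul_assoc _ _ (NormedSpace.exp (-A)), exp_smul_mul_exp_neg]

theorem neg_I_smul_rotate {𝔸 : Type*} [Ring 𝔸] [Algebra ℂ 𝔸] {a b : 𝔸} (hab : b * a = 1)
    (R h u : 𝔸) :
    -(Complex.I • ((a * h * b - R) * (a * u))) =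
      (Complex.I • R) * a * u + a * -(Complex.I • (h * u)) := by
  have h1 : a * h * b * (a * u) = a * (h * u) := by
    rw [mul_assoc (a * h), ← mul_assoc b, hab, one_mul, mul_assoc]
  rw [sub_mul, h1, smul_sub, mul_neg, mul_smul_comm, smul_mul_assoc, smul_mul_assoc,
    ← mul_assoc R]
  abel

/-- With R the integral term of `rotate`, Duhamel's formula gives ∂_t e^{-A} = iR e^{-A} almost
everywhere. Adding e^{-A} ∂_t U yields -i (e^{-A} h e^{A} - R) e^{-A} U. -/
theorem IsEvolution.rotate {T : ℝ} {h U : ℝ → Obs Λ q} (H : IsRegular T h)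
    (E : IsEvolution h U) :
    IsEvolution (SlowHeating.rotate T h) fun t => NormedSpace.exp (-rotGen T h t) * U t := by
  have hA : ∀ᵐ t, HasDerivAt (fun s => -rotGen T h s) (Complex.I • osc T h t) t := by
    filter_upwards [LocallyIntegrable.ae_hasDerivAt_integral H.osc.locallyIntegrable] with t ht
    have h1 : HasDerivAt (fun t => Complex.I • ∫ s in (0 : ℝ)..t, osc T h s)
      (Complex.I • osc T h t) t := (ht 0).const_smul Complex.I
    refine h1.congr_of_eventuallyEq (Filter.Eventually.of_forall fun s => ?_)
    exact neg_neg (Complex.I • ∫ s in (0 : ℝ)..s, osc T h s)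
  have hLA : LocallyLipschitz fun s => -rotGen T h s := by
    obtain ⟨B, hB⟩ := H.osc.bounded
    have h1 := locallyLipschitz_primitive H.osc.measurable (fun _ => ⟨B, fun t _ => hB t⟩) 0
    have h2 := locallyLipschitz_mul (LocallyLipschitz.const (Complex.I • (1 : Obs Λ q))) h1
    have h4 : ∀ A : Obs Λ q, (Complex.I • (1 : Obs Λ q)) * A = Complex.I • A := fun A => by
      rw [smul_mul_assoc, one_mul]
    simp only [h4] at h2
    have h5 : (fun s => -rotGen T h s) = fun t => Complex.I • ∫ s in (0 : ℝ)..t, osc T h s :=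
      funext fun s => neg_neg _
    rw [h5]
    exact h2
  refine ⟨locallyLipschitz_mul (locallyLipschitz_exp_obs hLA) E.locallyLipschitz, ?_, ?_⟩
  · filter_upwards [hA, E.hasDerivAt] with t h1 h2
    have h3 := hasDerivAt_mul_obs (hasDerivAt_exp_obs h1) h2
    convert h3 using 1
    rw [integral_exp_one_sub]
    have h4 : ∫ s in (0 : ℝ)..1, NormedSpace.exp (-(s • rotGen T h t)) * (Complex.I • osc T h t) *
        NormedSpace.exp (s • rotGen T h t) = Complex.I • ∫ s in (0 : ℝ)..1,
        NormedSpace.exp (-(s • rotGen T h t)) * osc T h t * NormedSpace.exp (s • rotGen T h t) := by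
      rw [← intervalIntegral.integral_smul]
      simp only [mul_smul_comm, smul_mul_assoc]
    rw [h4]
    exact neg_I_smul_rotate (exp_mul_exp_neg _) _ _ _
  · rw [rotGen_zero, neg_zero, NormedSpace.exp_zero, one_mul, E.zero]

/-- The evolution in the frame of `renHam T h k`. -/
def renEvolution (T : ℝ) (h U : ℝ → Obs Λ q) : ℕ → ℝ → Obs Λ q
  | 0 => U
  | k + 1 => fun t => NormedSpace.exp (-rotGen T (renHam T h k) t) * renEvolution T h U k t

theorem IsEvolution.renEvolution {T : ℝ} (hT : 0 < T) {h U : ℝ → Obs Λ q} (H : IsRegular T h)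
    (E : IsEvolution h U) (k : ℕ) :
    IsEvolution (renHam T h k) (renEvolution T h U k) := by
  induction k with
  | zero => exact E
  | succ k ih => exact ih.rotate (H.renHam hT k)

/-- All generators vanish at multiples of T; this is why the effective Hamiltonians are compared
only at those times. -/
theorem renEvolution_nat_mul {T : ℝ} (hT : 0 < T) {h U : ℝ → Obs Λ q} (H : IsRegular T h)
    (k m : ℕ) : renEvolution T h U k (m * T) = U (m * T) := by
  induction k with
  | zero => rfl
  | succ k ih =>
    change NormedSpace.exp (-rotGen T (renHam T h k) (m * T)) * SlowHeating.renEvolution T h U k (m * T) = _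
    rw [(H.renHam hT k).rotGen_nat_mul hT, neg_zero, NormedSpace.exp_zero, one_mul,
      ih]

end Frame

/-! ### Decay of the driving under repeated rotation -/

section Renormalisation

variable {d : ℕ} {Λ : Finset (Fin d → ℤ)} {q : ℕ}

theorem IsRegular.avg_sub_mem_localBall {κ M T : ℝ} (hκ : 0 ≤ κ) (hT : 0 < T) {h : ℝ → Obs Λ q}
    (H : IsRegular T h) (c : Obs Λ q) (hM : ∀ t, h t - c ∈ localBall Λ q κ M) :
    avg T h - c ∈ localBall Λ q κ M := by
  have h1 := integral_mem_smul_convex (convex_localBall κ M) (isClosed_localBall hκ M) hT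
    (fun t _ => hM t) ((H.intervalIntegrable 0 T).sub intervalIntegrable_const)
  rw [intervalIntegral.integral_sub (H.intervalIntegrable _ _) intervalIntegrable_const,
    intervalIntegral.integral_const, sub_zero, smul_sub, smul_smul, inv_mul_cancel₀ hT.ne',
    one_smul_obs, ← one_div] at h1
  exact h1

theorem exp_neg_conj_sub_mem_localBall {κ κ' M M' : ℝ} (hκ : 0 ≤ κ') (h : κ' < κ)
    {A Z : Obs Λ q} (hA : A ∈ localBall Λ q κ M) (hZ : Z ∈ localBall Λ q κ M')
    (hM : 0 ≤ M) (hM' : 0 ≤ M') (hs : 8 * M ≤ κ - κ') :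
    NormedSpace.exp (-A) * Z * NormedSpace.exp A - Z ∈
      localBall Λ q κ' (8 * M / (κ - κ') * M') := by
  simpa using exp_conj_sub_mem_localBall hκ h (neg_mem_localBall hA) hZ hM hM' hs

/-- With f = D + V the difference is (e^{-A} D e^{A} - D) + (e^{-A} V e^{A} - V) - ∫ (e^{-sA} V
e^{sA} - V) ds, the bare V cancelling. Three conjugation errors give dd + v + v. -/
theorem IsRegular.rotate_sub_avg_mem_localBall {κ κ' T dd v : ℝ} (hκ : 0 ≤ κ') (h : κ' < κ)
    (hT : 0 < T) {f : ℝ → Obs Λ q} (H : IsRegular T f) (hdd : 0 ≤ dd) (hv : 0 ≤ v)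
    (hD : avg T f ∈ localBall Λ q κ dd) (hV : ∀ t, SlowHeating.osc T f t ∈ localBall Λ q κ v)
    (hs : 8 * (T * v) ≤ κ - κ') (t : ℝ) :
    SlowHeating.rotate T f t - avg T f ∈
      localBall Λ q κ' (8 * (T * v) / (κ - κ') * (dd + 2 * v)) := by
  have hTv : 0 ≤ T * v := by positivity
  have hδ : 0 < κ - κ' := sub_pos.2 h
  have hA := H.rotGen_mem_localBall (hκ.trans h.le) hv hT hV t
  have h1 := exp_neg_conj_sub_mem_localBall hκ h hA hD hTv hdd hs
  have h2 := exp_neg_conj_sub_mem_localBall hκ h hA (hV t) hTv hv hs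
  have h3 : ∀ s ∈ Set.Ioc (0 : ℝ) 1, NormedSpace.exp (-(s • rotGen T f t)) *
      SlowHeating.osc T f t * NormedSpace.exp (s • rotGen T f t) - SlowHeating.osc T f t ∈
      localBall Λ q κ' (8 * (T * v) / (κ - κ') * v) := fun s hs' => by
    refine exp_neg_conj_sub_mem_localBall hκ h (localBall_mono ?_ (real_smul_mem_localBall s hA))
      (hV t) hTv hv hs
    rw [abs_of_pos hs'.1]
    exact mul_le_of_le_one_left hTv hs'.2
  have hc := (continuous_exp_conj (rotGen T f t) (SlowHeating.osc T f t)).intervalIntegrable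
    (μ := volume) 0 1
  have h4 := integral_mem_localBall hκ zero_le_one h3 (hc.sub intervalIntegrable_const)
  rw [intervalIntegral.integral_sub hc intervalIntegrable_const, intervalIntegral.integral_const,
    sub_zero, one_mul, one_smul_obs] at h4
  have h5 := sub_mem_localBall (add_mem_localBall h1 h2) h4
  have h6 : f t = avg T f + SlowHeating.osc T f t := by
    rw [SlowHeating.osc, add_sub_cancel]
  have h7 : NormedSpace.exp (-rotGen T f t) * f t * NormedSpace.exp (rotGen T f t) =
      NormedSpace.exp (-rotGen T f t) * avg T f * NormedSpace.exp (rotGen T f t) +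
      NormedSpace.exp (-rotGen T f t) * SlowHeating.osc T f t *
        NormedSpace.exp (rotGen T f t) := by
    rw [← add_mul, ← mul_add, ← h6]
  rw [SlowHeating.rotate, h7]
  convert h5 using 1
  · congr 1
    ring
  · abel

theorem IsRegular.osc_rotate_mem_localBall {κ w T : ℝ} (hκ : 0 ≤ κ) (hT : 0 < T)
    {f : ℝ → Obs Λ q} (H : IsRegular T f)
    (hW : ∀ t, SlowHeating.rotate T f t - avg T f ∈ localBall Λ q κ w) (t : ℝ) :
    SlowHeating.osc T (SlowHeating.rotate T f) t ∈ localBall Λ q κ (2 * w) := by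
  have h1 := sub_mem_localBall (hW t) ((H.rotate hT).avg_sub_mem_localBall hκ hT _ hW)
  rw [sub_sub_sub_cancel_right, ← two_mul] at h1
  exact h1

/-- The decay of the driving along the renormalisation, and the total displacement of the
effective Hamiltonians. -/
theorem IsRegular.renHam_mem_localBall {κ T dd v r : ℝ} {N : ℕ} (hκ : 0 < κ) (hT : 0 < T)
    {f : ℝ → Obs Λ q} (H : IsRegular T f) (hdd : 0 ≤ dd) (hv : 0 ≤ v)
    (hD : avg T f ∈ localBall Λ q κ dd) (hV : ∀ t, SlowHeating.osc T f t ∈ localBall Λ q κ v)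
    (hr : 24 ≤ r) (hN : 8 * (N : ℝ) ≤ r) (hg : 27 * r * (8 * T * (dd + 2 * v)) ≤ 32 * κ)
    (j : ℕ) (hj : j < N) :
    (∀ t, SlowHeating.osc T (SlowHeating.renHam T f (j + 1)) t ∈
      localBall Λ q (κ / 2 - j * (κ / (2 * N))) (6 * v / r * (2 / 3) ^ j)) ∧
    effHam T f (j + 1) - avg T f ∈
      localBall Λ q (κ / 2 - j * (κ / (2 * N))) (9 * v / r - 6 * v / r * (2 / 3) ^ j) := by
  have hr0 : 0 < r := by linarith
  have hN0 : (0 : ℝ) < N := by exact_mod_cast (Nat.zero_le j).trans_lt hj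
  have hg0 : 0 ≤ 8 * T * (dd + 2 * v) := by positivity
  induction j with
  | zero =>
    -- The first rotation drops the rate from κ to κ/2. By `hg` the remainder is at most (64/27) v/r
    -- ≤ 3v/r, and subtracting its mean doubles this to 6v/r.
    have hgκ : 8 * T * (dd + 2 * v) ≤ κ / 2 := by nlinarith
    have hs : 8 * (T * v) ≤ κ - κ / 2 := by
      have : 0 ≤ T * dd := by positivity
      have : 0 ≤ T * v := by positivity
      nlinarith
    have hw : 8 * (T * v) / (κ - κ / 2) * (dd + 2 * v) ≤ 3 * v / r := by
      have h1 : 8 * (T * v) / (κ - κ / 2) * (dd + 2 * v) =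
          v * (2 * (8 * T * (dd + 2 * v))) / κ := by
        field_simp
        ring
      rw [h1, div_le_div_iff₀ hκ hr0]
      nlinarith
    have hW : ∀ t, SlowHeating.rotate T f t - avg T f ∈ localBall Λ q (κ / 2) (3 * v / r) :=
      fun t => localBall_mono hw
        (H.rotate_sub_avg_mem_localBall (by positivity) (by linarith) hT hdd hv hD hV hs t)
    simp only [Nat.cast_zero, zero_mul, sub_zero, pow_zero, mul_one]
    refine ⟨fun t => localBall_mono (le_of_eq ?_)
      (H.osc_rotate_mem_localBall (by positivity) hT hW t), localBall_mono (le_of_eq ?_)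
      ((H.rotate hT).avg_sub_mem_localBall (by positivity) hT _ hW)⟩ <;> ring
  | succ j ih =>
    obtain ⟨ih1, ih2⟩ := ih (Nat.lt_of_succ_lt hj)
    set κj := κ / 2 - j * (κ / (2 * N)) with hκj
    set vj := 6 * v / r * (2 / 3 : ℝ) ^ j with hvj
    set δ := κ / (2 * N) with hδ
    have hδ0 : 0 < δ := by positivity
    have hj' : (j : ℝ) + 1 ≤ N := by exact_mod_cast hj.le
    have hκ' : 0 ≤ κ / 2 - ((j + 1 : ℕ) : ℝ) * δ := by
      have h1 : ((j : ℝ) + 1) * δ ≤ N * δ := by gcongr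
      have h2 : N * δ = κ / 2 := by
        rw [hδ]
        field_simp
      push_cast
      linarith
    have hsub : κj - (κ / 2 - ((j + 1 : ℕ) : ℝ) * δ) = δ := by
      rw [hκj]
      push_cast
      ring
    have hvj0 : 0 ≤ vj := by positivity
    have hvj1 : vj ≤ 6 * v / r :=
      mul_le_of_le_one_right (by positivity) (pow_le_one₀ (by norm_num) (by norm_num))
    have hvr : 15 * v / r ≤ 2 * v := by
      rw [div_le_iff₀ hr0]
      nlinarith
    -- The drifted average plus twice the current driving stays within the initial budget, so one
    -- smallness condition serves all steps.
    have hsum : dd + (9 * v / r - vj) + 2 * vj ≤ dd + 2 * v := by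
      have : 9 * v / r + 6 * v / r = 15 * v / r := by ring
      linarith
    have hdj : 0 ≤ dd + (9 * v / r - vj) := by
      have : 6 * v / r ≤ 9 * v / r := by gcongr; norm_num
      linarith
    -- Here 8N ≤ r enters: with `hg` it gives 6N · 8T(dd + 2v) ≤ (8/9) κ. The 3 makes the remainder
    -- vj/3, and recentring doubles it to the next driving, (2/3) vj.
    have hgδ : 3 * (8 * T * (dd + 2 * v)) ≤ δ := by
      rw [hδ, le_div_iff₀ (by positivity)]
      have h1 : 8 * (N : ℝ) * (8 * T * (dd + 2 * v)) ≤ r * (8 * T * (dd + 2 * v)) := by gcongr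
      nlinarith
    have hHj := H.renHam hT (j + 1)
    have hDj : avg T (SlowHeating.renHam T f (j + 1)) ∈ localBall Λ q κj
        (dd + (9 * v / r - vj)) := by
      have h1 := add_mem_localBall (localBall_anti (κ' := κj) (by
        rw [hκj]
        have : 0 ≤ (j : ℝ) * δ := by positivity
        linarith) hD) ih2
      rwa [effHam, add_sub_cancel] at h1
    have hs : 8 * (T * vj) ≤ δ := by
      have h1 : 8 * T * (2 * vj) ≤ 8 * T * (dd + 2 * v) := by
        gcongr
        linarith
      have : 0 ≤ T * vj := by positivity
      nlinarith
    have hw : 8 * (T * vj) / δ * (dd + (9 * v / r - vj) + 2 * vj) ≤ vj / 3 := by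
      calc 8 * (T * vj) / δ * (dd + (9 * v / r - vj) + 2 * vj)
          ≤ 8 * (T * vj) / δ * (dd + 2 * v) := by gcongr
        _ = vj * (8 * T * (dd + 2 * v)) / δ := by ring
        _ ≤ vj / 3 := by
          rw [div_le_iff₀ hδ0]
          nlinarith
    have hW : ∀ t, SlowHeating.rotate T (SlowHeating.renHam T f (j + 1)) t -
        avg T (SlowHeating.renHam T f (j + 1)) ∈
        localBall Λ q (κ / 2 - ((j + 1 : ℕ) : ℝ) * δ) (vj / 3) := fun t => by
      have h1 := hHj.rotate_sub_avg_mem_localBall (κ := κj) hκ' (by linarith) hT hdj hvj0 hDj ih1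
        (by rwa [hsub]) t
      rw [hsub] at h1
      exact localBall_mono hw h1
    have hpow : 6 * v / r * (2 / 3 : ℝ) ^ (j + 1) = 2 * (vj / 3) := by
      rw [hvj]
      ring
    refine ⟨fun t => ?_, ?_⟩
    · rw [hpow]
      exact hHj.osc_rotate_mem_localBall hκ' hT hW t
    · have h1 := add_mem_localBall ((hHj.rotate hT).avg_sub_mem_localBall hκ' hT _ hW)
        (localBall_anti (κ' := κ / 2 - ((j + 1 : ℕ) : ℝ) * δ) (by linarith) ih2)
      rw [effHam, sub_add_sub_cancel] at h1
      rw [hpow]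
      -- The displacement telescopes: 9v/r - vj + vj/3 is 9v/r minus the next driving.
      exact localBall_mono (by linarith) h1

theorem norm_commutator_avg_le {κ T dd v : ℝ} (hκ : 0 ≤ κ) {f : ℝ → Obs Λ q}
    (hdd : 0 ≤ dd) (hD : avg T f ∈ localBall Λ q κ dd)
    (hV : ∀ t, SlowHeating.osc T f t ∈ localBall Λ q κ v) (t : ℝ) :
    ‖f t * avg T f - avg T f * f t‖ ≤ 2 * Λ.card * v * dd := by
  have h1 : f t * avg T f - avg T f * f t =
      SlowHeating.osc T f t * avg T f - avg T f * SlowHeating.osc T f t := by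
    rw [SlowHeating.osc, sub_mul, mul_sub, sub_sub_sub_cancel_right]
  rw [h1]
  exact norm_commutator_le_of_mem_localBall hκ (hV t) hD hdd

end Renormalisation

/-! ### From potentials to local balls -/

section Driven

variable {d : ℕ} {Λ : Finset (Fin d → ℤ)} {q : ℕ}

theorem potNorm_nonneg (κ : ℝ) (Z : Potential Λ q) : 0 ≤ potNorm κ Z :=
  Real.iSup_nonneg fun _ => Finset.sum_nonneg fun _ _ =>
    mul_nonneg (Real.exp_pos _).le (Real.iSup_nonneg fun _ => norm_nonneg _)

theorem total_mem_localBall {κ : ℝ} {Z : Potential Λ q}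
    (hact : ∀ S ∈ connSets Λ, ∀ t, ActsWithin S (Z S t))
    (hb : ∀ S ∈ connSets Λ, ∃ B : ℝ, ∀ t, ‖Z S t‖ ≤ B) (t : ℝ) :
    total Z t ∈ localBall Λ q κ (potNorm κ Z) := by
  refine ⟨fun S => Z S t, fun S hS => hact S hS t, fun x hx => ?_, rfl⟩
  unfold potNorm
  refine le_ciSup_of_le (Set.finite_range _).bddAbove (⟨x, hx⟩ : Λ)
    (Finset.sum_le_sum fun S hS => ?_)
  -- Boundedness makes the supremum over time genuine; for an unbounded function it would be 0 by
  -- default.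
  obtain ⟨B, hB⟩ := hb S (Finset.mem_filter.1 hS).1
  refine mul_le_mul_of_nonneg_left ?_ (Real.exp_pos _).le
  exact le_ciSup (f := fun t => ‖Z S t‖) ⟨B, by rintro _ ⟨t, rfl⟩; exact hB t⟩ t

variable {T : ℝ} {H : Potential Λ q}

theorem IsDriven.intervalIntegrable (h : IsDriven T H) {S : Finset (Fin d → ℤ)}
    (hS : S ∈ connSets Λ) (a b : ℝ) : IntervalIntegrable (H S) volume a b :=
  intervalIntegrable_of_locallyIntegrable
    (locallyIntegrable_of_bounded (h.measurable S hS) (h.bounded S hS)) a b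

theorem IsDriven.isRegular (h : IsDriven T H) : IsRegular T (total H) where
  measurable := Finset.aestronglyMeasurable_fun_sum _ h.measurable
  bounded := by
    choose! B hB using h.bounded
    exact ⟨∑ S ∈ connSets Λ, B S, fun t => norm_sum_le_of_le _ fun S hS => hB S hS t⟩
  periodic := fun t => Finset.sum_congr rfl fun S hS => h.periodic S hS t
  hermitian := h.hermitian

theorem IsDriven.total_avgPot (h : IsDriven T H) (t : ℝ) :
    total (avgPot T H) t = avg T (total H) := by
  simp only [total, avgPot, avg]
  rw [intervalIntegral.integral_finsetSum fun S hS => h.intervalIntegrable hS 0 T,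
    Finset.smul_sum]

theorem IsDriven.total_oscPot (h : IsDriven T H) (t : ℝ) :
    total (oscPot T H) t = osc T (total H) t := by
  rw [osc, ← h.total_avgPot t]
  simp only [total, oscPot, osc, avgPot]
  rw [Finset.sum_sub_distrib]

/-- The operators acting within S form a finite-dimensional, hence closed, subspace, so averages
stay in it. -/
theorem IsDriven.actsWithin_avg (h : IsDriven T H) (hT : 0 < T) {S : Finset (Fin d → ℤ)}
    (hS : S ∈ connSets Λ) : ActsWithin S (avg T (H S)) := by
  have h1 := integral_mem_smul_convex (s := (actingWithin S : Submodule ℂ (Obs Λ q)))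
    ((actingWithin S : Submodule ℂ (Obs Λ q)).restrictScalars ℝ).convex
    (Submodule.closed_of_finiteDimensional _) hT
    (fun t _ => h.actsWithin S hS t) (h.intervalIntegrable hS 0 T)
  rw [sub_zero, ← one_div] at h1
  exact h1

theorem IsDriven.avg_mem_localBall (h : IsDriven T H) (hT : 0 < T) (κ : ℝ) :
    avg T (total H) ∈ localBall Λ q κ (potNorm κ (avgPot T H)) := by
  rw [← h.total_avgPot 0]
  exact total_mem_localBall (fun S hS _ => h.actsWithin_avg hT hS)
    (fun S _ => ⟨‖avg T (H S)‖, fun _ => le_rfl⟩) 0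

theorem IsDriven.osc_mem_localBall (h : IsDriven T H) (hT : 0 < T) (κ t : ℝ) :
    osc T (total H) t ∈ localBall Λ q κ (potNorm κ (oscPot T H)) := by
  rw [← h.total_oscPot t]
  refine total_mem_localBall (fun S hS t => ?_) (fun S hS => ?_) t
  · exact (actingWithin S).sub_mem (h.actsWithin S hS t) (h.actsWithin_avg hT hS)
  · obtain ⟨B, hB⟩ := h.bounded S hS
    exact ⟨B + ‖avg T (H S)‖, fun t => (norm_sub_le _ _).trans (add_le_add_left (hB t) _)⟩

end Driven

/-! ### Energy absorption -/

section Heating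

/-- From n ≥ 1 one gets r ≥ 3 > e, so 1 + ln r ≥ 2 and its cube is at least 8. Nothing else about
the logarithm is needed. -/
theorem mul_add_two_le_of_eq_nStar {r : ℝ} (hr : 1 ≤ r) {n : ℕ} (hn : (n : ℤ) = nStar r)
    (h1 : 1 ≤ n) : 8 * ((n : ℝ) + 2) ≤ r := by
  have hl : 0 ≤ Real.log r := Real.log_nonneg hr
  have hx : (n : ℝ) + 2 ≤ r / (1 + Real.log r) ^ 3 := by
    have h2 : ((n + 2 : ℤ) : ℝ) ≤ r / (1 + Real.log r) ^ 3 := by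
      rw [← Int.le_floor]
      unfold nStar at hn
      omega
    exact_mod_cast h2
  have hn1 : (1 : ℝ) ≤ n := by exact_mod_cast h1
  have hr3 : 3 ≤ r := by
    have : r / (1 + Real.log r) ^ 3 ≤ r :=
      div_le_self (by linarith) (one_le_pow₀ (by linarith))
    linarith
  have hl1 : 1 ≤ Real.log r := by
    rw [Real.le_log_iff_exp_le (by linarith)]
    have := Real.exp_one_lt_d9
    linarith
  have h8 : (8 : ℝ) ≤ (1 + Real.log r) ^ 3 := by
    calc (8 : ℝ) = 2 ^ 3 := by norm_num
      _ ≤ (1 + Real.log r) ^ 3 := by gcongr; linarith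
  rw [le_div_iff₀ (by positivity)] at hx
  nlinarith

variable {d : ℕ} {Λ : Finset (Fin d → ℤ)} {q : ℕ}

theorem norm_conj_sub_le_of_sub_mem {T κ dd dd' v : ℝ} (hκ : 0 ≤ κ) {f U : ℝ → Obs Λ q}
    (H : IsRegular T f) (E : IsEvolution f U) {D : Obs Λ q} (hdd : 0 ≤ dd + dd')
    (hD : D ∈ localBall Λ q κ dd) (hD' : avg T f - D ∈ localBall Λ q κ dd')
    (hV : ∀ t, osc T f t ∈ localBall Λ q κ v) {t : ℝ} (ht : 0 ≤ t) :
    ‖star (U t) * avg T f * U t - avg T f‖ ≤ t * (2 * Λ.card * v * (dd + dd')) := by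
  have h1 := add_mem_localBall hD hD'
  rw [add_sub_cancel] at h1
  have h2 := E.norm_conj_sub_le H (fun t => norm_commutator_avg_le hκ hdd h1 hV t) ht
  rw [E.zero, star_one, one_mul, mul_one, sub_zero] at h2
  exact h2

/-- Slow heating at multiples of the period, for the effective Hamiltonian of order `j + 1`. -/
theorem effHam_heating {κ T dd v r : ℝ} {N : ℕ} (hκ : 0 < κ) (hT : 0 < T)
    {f U : ℝ → Obs Λ q} (H : IsRegular T f) (E : IsEvolution f U) (hdd : 0 ≤ dd) (hv : 0 ≤ v)
    (hD : avg T f ∈ localBall Λ q κ dd) (hV : ∀ t, osc T f t ∈ localBall Λ q κ v)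
    (hr : 24 ≤ r) (hN : 8 * (N : ℝ) ≤ r) (hg : 27 * r * (8 * T * (dd + 2 * v)) ≤ 32 * κ)
    (j : ℕ) (hj : j < N) (m : ℕ) :
    ‖star (U (m * T)) * effHam T f (j + 1) * U (m * T) - effHam T f (j + 1)‖ ≤
      m * T * (2 * Λ.card * (6 * v / r * (2 / 3) ^ j) * (dd + 9 * v / r)) ∧
    ‖effHam T f (j + 1) - avg T f‖ ≤ Λ.card * (9 * v / r) := by
  have hr0 : 0 < r := by linarith
  have hN0 : (0 : ℝ) < N := by exact_mod_cast (Nat.zero_le j).trans_lt hj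
  obtain ⟨h1, h2⟩ := H.renHam_mem_localBall hκ hT hdd hv hD hV hr hN hg j hj
  set κj := κ / 2 - j * (κ / (2 * N))
  have hκj : 0 ≤ κj := by
    have hj' : (j : ℝ) ≤ N := by exact_mod_cast hj.le
    have h3 : (j : ℝ) * (κ / (2 * N)) ≤ N * (κ / (2 * N)) := by gcongr
    have h4 : N * (κ / (2 * N)) = κ / 2 := by field_simp
    simp only [κj]
    linarith
  have hκj' : κj ≤ κ := by
    have : 0 ≤ (j : ℝ) * (κ / (2 * N)) := by positivity
    simp only [κj]
    linarith
  have h3 := localBall_mono (M' := 9 * v / r) (sub_le_self _ (by positivity)) h2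
  refine ⟨?_, norm_le_of_mem_localBall hκj h3⟩
  have h4 := norm_conj_sub_le_of_sub_mem hκj (H.renHam hT (j + 1)) (E.renEvolution hT H (j + 1))
    (by positivity) (localBall_anti hκj' hD) h3 h1 (t := m * T) (by positivity)
  rw [renEvolution_nat_mul hT H] at h4
  exact h4

/-- Slow heating at all times, for the averaged Hamiltonian. -/
theorem avg_heating {κ T dd v r : ℝ} {N : ℕ} (hκ : 0 < κ) (hT : 0 < T)
    {f U : ℝ → Obs Λ q} (H : IsRegular T f) (E : IsEvolution f U) (hdd : 0 ≤ dd) (hv : 0 ≤ v)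
    (hD : avg T f ∈ localBall Λ q κ dd) (hV : ∀ t, osc T f t ∈ localBall Λ q κ v)
    (hr : 24 ≤ r) (hN : 8 * (N : ℝ) ≤ r) (hg : 27 * r * (8 * T * (dd + 2 * v)) ≤ 32 * κ)
    (j : ℕ) (hj : j < N) {t : ℝ} (ht : 0 ≤ t) :
    ‖star (U t) * avg T f * U t - avg T f‖ ≤
      t * (2 * Λ.card * (6 * v / r * (2 / 3) ^ j) * (dd + 9 * v / r)) +
        Λ.card * (18 * v / r + T * (2 * v * dd)) := by
  have hr0 : 0 < r := by linarith
  set m := ⌊t / T⌋₊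
  have hm1 : m * T ≤ t := by
    rw [← le_div_iff₀ hT]
    exact Nat.floor_le (by positivity)
  have hm2 : t - m * T ≤ T := by
    have := Nat.lt_floor_add_one (t / T)
    rw [div_lt_iff₀ hT] at this
    linarith
  obtain ⟨h1, h2⟩ := effHam_heating hκ hT H E hdd hv hD hV hr hN hg j hj m
  have h3 := E.norm_conj_sub_le H
    (fun t => norm_commutator_avg_le hκ.le hdd hD hV t) hm1
  set Dj := effHam T f (j + 1)
  set D := avg T f
  set u := U (m * T)
  have h4 : ‖star u * (Dj - D) * u‖ ≤ Λ.card * (9 * v / r) :=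
    (E.norm_conj_le H (m * T) _).trans h2
  -- Drift since the last multiple of T, then the slow motion of Dj up to that time, then the
  -- exchange of D for Dj, paid twice.
  have h5 : star (U t) * D * U t - D = (star (U t) * D * U t - star u * D * u) +
      (star u * Dj * u - Dj) + (Dj - D) - star u * (Dj - D) * u := by
    rw [mul_sub, sub_mul]
    abel
  have h6 : m * T * (2 * Λ.card * (6 * v / r * (2 / 3) ^ j) * (dd + 9 * v / r)) ≤
      t * (2 * Λ.card * (6 * v / r * (2 / 3) ^ j) * (dd + 9 * v / r)) := by gcongr
  have h7 : (t - m * T) * (2 * Λ.card * v * dd) ≤ T * (2 * Λ.card * v * dd) := by gcongr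
  calc ‖star (U t) * D * U t - D‖
      ≤ ‖star (U t) * D * U t - star u * D * u‖ + ‖star u * Dj * u - Dj‖ + ‖Dj - D‖ +
        ‖star u * (Dj - D) * u‖ := by
        rw [h5]
        refine (norm_sub_le _ _).trans (add_le_add_left ?_ _)
        refine (norm_add_le _ _).trans (add_le_add_left ?_ _)
        exact norm_add_le _ _
    _ ≤ T * (2 * Λ.card * v * dd) +
        t * (2 * Λ.card * (6 * v / r * (2 / 3) ^ j) * (dd + 9 * v / r)) +
        Λ.card * (9 * v / r) + Λ.card * (9 * v / r) := by linarith
    _ = _ := by ring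

end Heating

end SlowHeating

end

/-! ### Choice of constants and conclusion -/

theorem theorem2 :
    ∃ C : ℝ, 0 < C ∧
      ∀ (d q : ℕ) (Λ : Finset (Fin d → ℤ)) (T κ₀ ν ν₀ normD normV : ℝ)
        (H : SlowHeating.Potential Λ q) (D : SlowHeating.Obs Λ q)
        (U : ℝ → SlowHeating.Obs Λ q) (n : ℕ),
        0 < T → 0 < κ₀ →
        SlowHeating.IsDriven T H →
        SlowHeating.IsPropagator (SlowHeating.total H) U →
        ν = 2 * Real.pi / T →
        ν₀ = SlowHeating.nuZero T κ₀ H →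
        D = SlowHeating.avg T (SlowHeating.total H) →
        normD = SlowHeating.potNorm κ₀ (SlowHeating.avgPot T H) →
        normV = SlowHeating.potNorm κ₀ (SlowHeating.oscPot T H) →
        9 * Real.pi * normV / κ₀ ≤ ν →
        ν₀ ≤ ν →
        (n : ℤ) = SlowHeating.nStar (ν / ν₀) →
        1 ≤ n →
        (∀ Dhat : SlowHeating.Obs Λ q,
          (Dhat = SlowHeating.effHam T (SlowHeating.total H) n ∨
            Dhat = SlowHeating.effHam T (SlowHeating.total H) (n + 1)) →
          ∀ (m : ℕ) (t : ℝ), t = m * T →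
            1 / (Λ.card : ℝ) * ‖star (U t) * Dhat * U t - Dhat‖ ≤
              t * (C * max normD (ν₀ / ν * normV) * normV) * (2 / 3 : ℝ) ^ n) ∧
        (∀ t : ℝ, 0 ≤ t →
          1 / (Λ.card : ℝ) * ‖star (U t) * D * U t - D‖ ≤
            t * (C * normD * normV) * (2 / 3 : ℝ) ^ n + C * (ν₀ / ν) * normV) := by
  -- The heating rate needs 15/2 and the constant error term 18 + 1.
  refine ⟨20, by norm_num, ?_⟩
  intro d q Λ T κ₀ ν ν₀ nD nV H D U n hT hκ₀ hH hU hν hν₀ hD hnD hnV _ hle hn hn1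
  have hnD0 : 0 ≤ nD := hnD ▸ SlowHeating.potNorm_nonneg _ _
  have hnV0 : 0 ≤ nV := hnV ▸ SlowHeating.potNorm_nonneg _ _
  have hν0 : 0 < ν := by rw [hν]; positivity
  rw [SlowHeating.nuZero, ← hnD, ← hnV] at hν₀
  have hν₀0 : 0 < ν₀ := by
    -- If ν₀ were 0, then ν/ν₀ would be 0 by convention and `nStar` would equal -2, which is no
    -- natural number.
    refine lt_of_le_of_ne (by rw [hν₀]; positivity) fun h0 => ?_
    rw [← h0, div_zero] at hn
    simp [SlowHeating.nStar] at hn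
  set r := ν / ν₀ with hr
  have hr1 : 1 ≤ r := (one_le_div hν₀0).2 hle
  have hn8 := SlowHeating.mul_add_two_le_of_eq_nStar hr1 hn hn1
  have hn1' : (1 : ℝ) ≤ n := by exact_mod_cast hn1
  have hr24 : 24 ≤ r := by linarith
  have hr0 : 0 < r := by linarith
  have hinv : ν₀ / ν * nV = nV / r := by rw [hr]; field_simp
  -- Working at rate κ₀/2 gains this factor on both norms. The definition of ν₀ gives rT(nD + 2nV) =
  -- κ₀²/27, quadratic in κ₀, whereas `hg` must be linear; (κ₀/2) c ≤ 1 removes the extra power even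
  -- for large κ₀.
  set c := Real.exp (-(κ₀ / 2)) with hc
  have hc0 : 0 < c := Real.exp_pos _
  have hc1 : c ≤ 1 := Real.exp_le_one_iff.2 (by linarith)
  have hκc : κ₀ / 2 * c ≤ 1 := by
    have h1 := Real.add_one_le_exp (κ₀ / 2)
    have h2 : Real.exp (κ₀ / 2) * c = 1 := by rw [hc, ← Real.exp_add, add_neg_cancel, Real.exp_zero]
    nlinarith
  have hreg := hH.isRegular
  have hE := SlowHeating.IsPropagator.isEvolution hreg hU
  have hshift : κ₀ / 2 - κ₀ = -(κ₀ / 2) := by ring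
  have hD1 : SlowHeating.avg T (SlowHeating.total H) ∈
      SlowHeating.localBall Λ q (κ₀ / 2) (c * nD) := by
    have := SlowHeating.localBall_subset_exp_mul (κ' := κ₀ / 2) (by linarith)
      (hH.avg_mem_localBall hT κ₀)
    rwa [hshift, ← hnD] at this
  have hV1 : ∀ t, SlowHeating.osc T (SlowHeating.total H) t ∈
      SlowHeating.localBall Λ q (κ₀ / 2) (c * nV) := fun t => by
    have := SlowHeating.localBall_subset_exp_mul (κ' := κ₀ / 2) (by linarith)
      (hH.osc_mem_localBall hT κ₀ t)
    rwa [hshift, ← hnV] at this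
  have hg : 27 * r * (8 * T * (c * nD + 2 * (c * nV))) ≤ 32 * (κ₀ / 2) := by
    have h1 : r * T * (nD + 2 * nV) = κ₀ ^ 2 / 27 := by
      have h2 : r * T = 2 * Real.pi / ν₀ := by
        rw [hr, hν]
        field_simp
      have h3 : nD + 2 * nV = ν₀ * κ₀ ^ 2 / (54 * Real.pi) := by
        rw [hν₀]
        have := Real.pi_pos
        field_simp
      rw [h2, h3]
      have := Real.pi_pos
      field_simp
      norm_num
    calc 27 * r * (8 * T * (c * nD + 2 * (c * nV)))
        = 27 * 8 * c * (r * T * (nD + 2 * nV)) := by ring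
      _ = 16 * κ₀ * (κ₀ / 2 * c) := by rw [h1]; ring
      _ ≤ 16 * κ₀ * 1 := by gcongr
      _ = _ := by ring
  have hN : 8 * ((n + 2 : ℕ) : ℝ) ≤ r := by push_cast; exact hn8
  have hκ : 0 < κ₀ / 2 := by linarith
  have hcD : c * nD ≤ nD := mul_le_of_le_one_left hnD0 hc1
  have hcV : c * nV ≤ nV := mul_le_of_le_one_left hnV0 hc1
  have hcD0 : 0 ≤ c * nD := by positivity
  have hcV0 : 0 ≤ c * nV := by positivity
  have hmaxD : nD ≤ max nD (nV / r) := le_max_left _ _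
  have hmaxV : nV / r ≤ max nD (nV / r) := le_max_right _ _
  have hM0 : 0 ≤ max nD (nV / r) := hnD0.trans hmaxD
  have hcVr : c * nV / r ≤ nV / r := by gcongr
  -- The effective Hamiltonian of order j + 1 has j factors 2/3, so order n loses 3/2. The spare 1/r
  -- ≤ 1/24 in the driving compensates.
  have hrate : ∀ j, n ≤ j + 1 → 2 * (6 * (c * nV) / r * (2 / 3 : ℝ) ^ j) *
      (c * nD + 9 * (c * nV) / r) ≤ 20 * max nD (nV / r) * nV * (2 / 3) ^ n := by
    intro j hj
    have h1 : (2 / 3 : ℝ) ^ j ≤ 3 / 2 * (2 / 3) ^ n := by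
      have : (2 / 3 : ℝ) ^ (j + 1) ≤ (2 / 3) ^ n :=
        pow_le_pow_of_le_one (by norm_num) (by norm_num) hj
      rw [pow_succ] at this
      linarith
    have h2 : 6 * (c * nV) / r ≤ nV / 4 := by
      rw [div_le_div_iff₀ hr0 (by norm_num)]
      nlinarith
    have h3 : c * nD + 9 * (c * nV) / r ≤ 10 * max nD (nV / r) := by
      have : 9 * (c * nV) / r = 9 * (c * nV / r) := by ring
      linarith
    calc 2 * (6 * (c * nV) / r * (2 / 3 : ℝ) ^ j) * (c * nD + 9 * (c * nV) / r)
        ≤ 2 * (nV / 4 * (3 / 2 * (2 / 3) ^ n)) * (10 * max nD (nV / r)) := by gcongr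
      _ = 15 / 2 * (max nD (nV / r) * nV * (2 / 3) ^ n) := by ring
      _ ≤ 20 * (max nD (nV / r) * nV * (2 / 3) ^ n) := by gcongr; norm_num
      _ = _ := by ring
  have hdiv : ∀ {x y : ℝ}, 0 ≤ y → x ≤ Λ.card * y → 1 / (Λ.card : ℝ) * x ≤ y := by
    intro x y hy hxy
    rcases Nat.eq_zero_or_pos Λ.card with h0 | h0
    -- For empty Λ the prefactor 1/0 is 0.
    · simpa [h0] using hy
    · have : (0 : ℝ) < Λ.card := by exact_mod_cast h0
      rw [one_div, inv_mul_le_iff₀ this]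
      exact hxy
  constructor
  · intro Dhat hDhat m t ht
    obtain ⟨j, hj1, hj2, rfl⟩ : ∃ j, n ≤ j + 1 ∧ j < n + 2 ∧
        Dhat = SlowHeating.effHam T (SlowHeating.total H) (j + 1) := by
      rcases hDhat with h | h
      · exact ⟨n - 1, by omega, by omega, by rw [h, Nat.sub_add_cancel hn1]⟩
      · exact ⟨n, by omega, by omega, h⟩
    have h1 := (SlowHeating.effHam_heating hκ hT hreg hE hcD0 hcV0 hD1 hV1 hr24 hN hg j hj2 m).1
    rw [← ht] at h1
    have ht0 : 0 ≤ t := by rw [ht]; positivity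
    rw [hinv]
    refine hdiv (by positivity) (h1.trans ?_)
    calc t * (2 * Λ.card * (6 * (c * nV) / r * (2 / 3 : ℝ) ^ j) * (c * nD + 9 * (c * nV) / r))
        = Λ.card * (t * (2 * (6 * (c * nV) / r * (2 / 3 : ℝ) ^ j) *
            (c * nD + 9 * (c * nV) / r))) := by ring
      _ ≤ Λ.card * (t * (20 * max nD (nV / r) * nV * (2 / 3) ^ n)) := by
          exact mul_le_mul_of_nonneg_left (mul_le_mul_of_nonneg_left (hrate j hj1) ht0)
            (Nat.cast_nonneg _)
      _ = _ := by ring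
  · intro t ht
    rw [hD, mul_assoc 20 (ν₀ / ν), hinv]
    refine hdiv (by positivity) ?_
    -- The second bound has nD instead of the maximum in its rate. When nD is the smaller of the
    -- two, the trivial estimate 2‖D‖ already fits into the error term nV/r.
    rcases le_total (nV / r) nD with hcase | hcase
    · have h1 := SlowHeating.avg_heating hκ hT hreg hE hcD0 hcV0 hD1 hV1 hr24 hN hg n (by omega) ht
      have h2 := hrate n (by omega)
      rw [max_eq_left hcase] at h2
      -- The drift over a partial period is of order nV/r because `hg` bounds rT c nD by a multiple
      -- of κ₀, and the other factor c absorbs κ₀.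
      have h3 : T * (2 * (c * nV) * (c * nD)) ≤ nV / r := by
        rw [le_div_iff₀ hr0]
        have h4 : 216 * (r * T * (c * nD)) ≤ 32 * (κ₀ / 2) := by
          have : 0 ≤ r * T * (c * nV) := by positivity
          linarith
        calc T * (2 * (c * nV) * (c * nD)) * r = 2 * (r * T * (c * nD)) * (c * nV) := by ring
          _ ≤ 2 * (32 * (κ₀ / 2) / 216) * (c * nV) := by
              gcongr
              linarith
          _ = 64 / 216 * (κ₀ / 2 * c) * nV := by ring
          _ ≤ 64 / 216 * 1 * nV := by gcongr
          _ ≤ nV := by linarith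
      have h5 : 18 * (c * nV) / r ≤ 18 * (nV / r) := by
        have : 18 * (c * nV) / r = 18 * (c * nV / r) := by ring
        linarith
      have h6 : 0 ≤ nV / r := by positivity
      calc _ ≤ _ := h1
        _ = Λ.card * (t * (2 * (6 * (c * nV) / r * (2 / 3 : ℝ) ^ n) *
            (c * nD + 9 * (c * nV) / r)) +
            (18 * (c * nV) / r + T * (2 * (c * nV) * (c * nD)))) := by ring
        _ ≤ Λ.card * (t * (20 * nD * nV * (2 / 3) ^ n) + 20 * (nV / r)) := by
            gcongr
            linarith
        _ = _ := by ring
    · have h1 := SlowHeating.norm_le_of_mem_localBall hκ.le hD1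
      have h2 := hE.norm_conj_le hreg t (SlowHeating.avg T (SlowHeating.total H))
      have h3 : 0 ≤ t * (20 * nD * nV) * (2 / 3 : ℝ) ^ n := by positivity
      calc _ ≤ _ := norm_sub_le _ _
        _ ≤ Λ.card * (c * nD) + Λ.card * (c * nD) := add_le_add (h2.trans h1) h1
        _ = Λ.card * (2 * (c * nD)) := by ring
        _ ≤ Λ.card * (t * (20 * nD * nV) * (2 / 3 : ℝ) ^ n + 20 * (nV / r)) := by
            gcongr
            linarith
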